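/- Let $\delta>0$, let $\Omega\subset\mathbb R^m$ be nonempty, and let $l:[0,\infty)\times\mathbb R^n\times\mathbb R^m\to\mathbb R$ and $f:[0,\infty)\times\mathbb R^n\times\mathbb R^m\to\mathbb R^n$ satisfy: - A1) there is $K_1>0$ with $|l(t,x,u)-l(t,z,u)|+|f(t,x,u)-f(t,z,u)|\le K_1|x-z|$ for all $t\ge 0$, $u\in\Omega$, $x,z\in\mathbb R^n$; - A2) there is $K_2>0$ with $|l(t,x,u)|+|f(t,x,u)|\le K_2(1+|x|)$ for all $t\ge0$, $x\in\mathbb R^n$, $u\in\Omega$; - A3) $l$ and $f$ are continuous; - A4) for all $t\ge0$, $x\in\mathbb R^n$ the set $\{(e^{-\delta t}l(t,x,v),f(t,x,v)) : v\in\Omega\}\subset\mathbb R^{1+n}$ is convex; - A5) $\Omega$ is compact. Put $\mathcal H(t,x,\xi)=\inf_{u\in\Omega}\{\langle\xi,f(t,x,u)\rangle+e^{-\delta t}l(t,x,u)\}$. For $\Phi:[0,\infty)\times\mathbb R^n\to\mathbb R$, a point $(t,x)\in[0,\infty)\times\mathbb R^n$ and a direction $(u,v)\in\mathbb R^{1+n}$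 let $$D^-\Phi(t,x;u,v)=\liminf_{r\downarrow0,\ w\to v}\frac{\Phi(t+ru,x+rw)-\Phi(t,x)}{r},\qquad D^+\Phi(t,x;u,v)=\limsup_{r\downarrow0,\ w\to v}\frac{\Phi(t+ru,x+rw)-\Phi(t,x)}{r},$$ with values in $[-\infty,+\infty]$; for $t=0$ and $u<0$, where the quotients are undefined, $D^-\Phi=+\infty$ and $D^+\Phi=-\infty$. Let - $\partial_D\Phi(t,x)$ (Dini sub-gradient) be the set of $(\alpha,\xi)\in\mathbb R^{1+n}$ with $D^-\Phi(t,x;u,v)\ge u\alpha+\langle v,\xi\rangle$ for all $(u,v)\in\mathbb R^{1+n}$; - $\partial^D\Phi(t,x)$ (Dini super-gradient) be the set of $(\alpha,\xi)\in\mathbb R^{1+n}$ with $D^+\Phi(t,x;u,v)\le u\alpha+\langle v,\xi\rangle$ for all $(u,v)\in\mathbb R^{1+n}$; - $\partial_P\Phi(t,x)$ (proximal sub-gradient) be the set of $(\alpha,\xi)\in\mathbb R^{1+n}$ for which there are $\sigma>0$ and a neighbourhood $U$ of $(t,x)$ in $[0,\infty)\times\mathbb R^n$ with $\Phi(\tau,y)\ge\Phi(t,x)+\alpha(\tau-t)+\langle\xi,y-x\rangle-\sigma(|\tau-t|^2+|y-x|^2)$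 for all $(\tau,y)\in U$. Let $\Phi:[0,\infty)\times\mathbb R^n\to\mathbb R$ be continuous. With $\sup\emptyset=-\infty$ and $\inf\emptyset=+\infty$, the following hold. (a) Let $J=[0,\infty)$ or $J=(0,\infty)$. Then $$\sup_{(\alpha,\xi)\in\partial_P\Phi(s,z)}\{\alpha+\mathcal H(s,z,\xi)\}\le0\ \ \forall (s,z)\in J\times\mathbb R^n \iff \sup_{(\alpha,\xi)\in\partial_D\Phi(s,z)}\{\alpha+\mathcal H(s,z,\xi)\}\le0\ \ \forall (s,z)\in J\times\mathbb R^n.$$ (b) Let $J=[0,\infty)$ or $J=(0,\infty)$. Then $$\inf_{(\alpha,\xi)\in\partial_P\Phi(s,z)}\{\alpha+\mathcal H(s,z,\xi)\}\ge0\ \ \forall (s,z)\in (0,\infty)\times\mathbb R^n \iff \inf_{(\alpha,\xi)\in\partial^D\Phi(s,z)}\{\alpha+\mathcal H(s,z,\xi)\}\ge0\ \ \forall (s,z)\in J\times\mathbb R^n.$$ -/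

import Mathlib

open Set Filter Topology

noncomputable section

/-- The pre-Hamiltonian `H(t,x,ξ,u) = ⟨ξ, f(t,x,u)⟩ + e^{-δt} l(t,x,u)`. -/
def preHamiltonian {n m : ℕ} (δ : ℝ)
    (l : ℝ → EuclideanSpace ℝ (Fin n) → EuclideanSpace ℝ (Fin m) → ℝ)
    (f : ℝ → EuclideanSpace ℝ (Fin n) → EuclideanSpace ℝ (Fin m) → EuclideanSpace ℝ (Fin n))
    (t : ℝ) (x ξ : EuclideanSpace ℝ (Fin n)) (u : EuclideanSpace ℝ (Fin m)) : ℝ :=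
  inner ℝ ξ (f t x u) + Real.exp (-δ * t) * l t x u

/-- The Hamiltonian `𝓗(t,x,ξ) = inf_{u ∈ Ω} H(t,x,ξ,u)`. The infimum is over a nonempty set that is
bounded below whenever `Ω` is nonempty and compact and `f`, `l` are continuous. -/
def hamiltonian {n m : ℕ} (δ : ℝ)
    (l : ℝ → EuclideanSpace ℝ (Fin n) → EuclideanSpace ℝ (Fin m) → ℝ)
    (f : ℝ → EuclideanSpace ℝ (Fin n) → EuclideanSpace ℝ (Fin m) → EuclideanSpace ℝ (Fin n))
    (Ω : Set (EuclideanSpace ℝ (Fin m)))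
    (t : ℝ) (x ξ : EuclideanSpace ℝ (Fin n)) : ℝ :=
  sInf ((fun u => preHamiltonian δ l f t x ξ u) '' Ω)

/-- The filter `r ↓ 0, w → ξ`, restricted to those `r` for which `t + r α` is an admissible time,
i.e. `0 ≤ t + r α`. The restriction matters only if `t = 0` and `α < 0`; then no difference quotient
is defined and the filter is trivial. -/
def diniFilter {n : ℕ} (t α : ℝ) (ξ : EuclideanSpace ℝ (Fin n)) :
    Filter (ℝ × EuclideanSpace ℝ (Fin n)) :=
  (𝓝[>] (0 : ℝ) ×ˢ 𝓝 ξ) ⊓ 𝓟 {q | 0 ≤ t + q.1 * α}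

/-- Lower Dini derivative of `Φ : [0,∞) × ℝⁿ → ℝ` at `(t,x)` in the direction `(α,ξ)`, with values
in the extended reals (`+∞` in directions that leave the time domain at once). -/
def lowerDini {n : ℕ} (Φ : ℝ → EuclideanSpace ℝ (Fin n) → ℝ)
    (t : ℝ) (x : EuclideanSpace ℝ (Fin n)) (α : ℝ) (ξ : EuclideanSpace ℝ (Fin n)) : EReal :=
  liminf (fun q : ℝ × EuclideanSpace ℝ (Fin n) =>
    (((Φ (t + q.1 * α) (x + q.1 • q.2) - Φ t x) / q.1 : ℝ) : EReal)) (diniFilter t α ξ)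

/-- Upper Dini derivative of `Φ : [0,∞) × ℝⁿ → ℝ` at `(t,x)` in the direction `(α,ξ)`, with values
in the extended reals (`-∞` in directions that leave the time domain at once). -/
def upperDini {n : ℕ} (Φ : ℝ → EuclideanSpace ℝ (Fin n) → ℝ)
    (t : ℝ) (x : EuclideanSpace ℝ (Fin n)) (α : ℝ) (ξ : EuclideanSpace ℝ (Fin n)) : EReal :=
  limsup (fun q : ℝ × EuclideanSpace ℝ (Fin n) =>
    (((Φ (t + q.1 * α) (x + q.1 • q.2) - Φ t x) / q.1 : ℝ) : EReal)) (diniFilter t α ξ)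

/-- The Dini sub-gradient `∂_D Φ(t,x)`. -/
def diniSubgrad {n : ℕ} (Φ : ℝ → EuclideanSpace ℝ (Fin n) → ℝ)
    (t : ℝ) (x : EuclideanSpace ℝ (Fin n)) : Set (ℝ × EuclideanSpace ℝ (Fin n)) :=
  {p | ∀ (u : ℝ) (v : EuclideanSpace ℝ (Fin n)),
    ((u * p.1 + inner ℝ v p.2 : ℝ) : EReal) ≤ lowerDini Φ t x u v}

/-- The Dini super-gradient `∂^D Φ(t,x)`. -/
def diniSupergrad {n : ℕ} (Φ : ℝ → EuclideanSpace ℝ (Fin n) → ℝ)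
    (t : ℝ) (x : EuclideanSpace ℝ (Fin n)) : Set (ℝ × EuclideanSpace ℝ (Fin n)) :=
  {p | ∀ (u : ℝ) (v : EuclideanSpace ℝ (Fin n)),
    upperDini Φ t x u v ≤ ((u * p.1 + inner ℝ v p.2 : ℝ) : EReal)}

/-- The proximal sub-gradient `∂_P Φ(t,x)`; neighbourhoods are taken in `[0,∞) × ℝⁿ`. -/
def proxSubgrad {n : ℕ} (Φ : ℝ → EuclideanSpace ℝ (Fin n) → ℝ)
    (t : ℝ) (x : EuclideanSpace ℝ (Fin n)) : Set (ℝ × EuclideanSpace ℝ (Fin n)) :=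
  {p | ∃ σ : ℝ, 0 < σ ∧ ∃ U ∈ 𝓝[Ici (0 : ℝ) ×ˢ univ] (t, x), ∀ q ∈ U,
    Φ q.1 q.2 ≥ Φ t x + p.1 * (q.1 - t) + inner ℝ p.2 (q.2 - x)
      - σ * (‖q.1 - t‖ ^ 2 + ‖q.2 - x‖ ^ 2)}

end

/-!
Doubling of variables gives a fuzzy sum rule: if `g + h` takes a smaller value inside a compact set
than anywhere on its boundary, then some `ζ` is a proximal subgradient of `g`, and `-ζ` one of `h`,
at two interior points that are as close as we like. Both parts apply it to `Φ` plus a penalty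
chosen to control `⟨ζ, f⟩`.

For (a), subtract from `Φ` its Dini subgradient at `(t, x)` and let `h` penalise the distance to the
forward cone with apex `(t, x)` whose speed `b` exceeds `‖f‖` nearby. This `h` does not increase
along any direction `(1, w)` with `‖w‖ ≤ b`, so the proximal subgradient of `Φ` that is found nearly
dominates the Dini subgradient on all `(1, f(q, u))` at once.

For (b), fix a control `u` and a solution `X` of `ẋ = f(t, x, u)`, and let `h` penalise the distance
to the graph of `X` with an exponential weight, which a backward solution does not increase. Hence
the proximal inequalities force `Φ + ∫ L` to be nondecreasing along `X`, where
`L = e^{-δt} l(·, ·, u)`; differentiating along `X` at its initial point yields the Dini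
supergradient inequality, including at `t = 0`. The converse is the same argument for `-Φ` with time
reversed.
-/

section Penalization

theorem exists_forall_lt_add_mul {α : Type*} [TopologicalSpace α] {S : Set α} (hS : IsCompact S)
    {g ψ : α → ℝ} (hg : ContinuousOn g S) (hψ : ContinuousOn ψ S) (hψ₀ : ∀ q ∈ S, 0 ≤ ψ q) {γ : ℝ}
    (hpos : ∀ q ∈ S, ψ q = 0 → γ < g q) : ∃ N : ℝ, 0 ≤ N ∧ ∀ q ∈ S, γ < g q + N * ψ q := by
  have hpt : ∀ q ∈ S, ∃ N : ℝ, 0 ≤ N ∧ γ < g q + N * ψ q := by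
    intro q hq
    rcases (hψ₀ q hq).eq_or_lt with h0 | h0
    · exact ⟨0, le_rfl, by simpa using hpos q hq h0.symm⟩
    · obtain ⟨N, hN⟩ := exists_nat_gt ((γ - g q) / ψ q)
      exact ⟨N, N.cast_nonneg, by linarith [(div_lt_iff₀ h0).1 hN]⟩
  suffices ∃ N : ℝ, 0 ≤ N ∧ ∀ q ∈ S, q ∈ S → γ < g q + N * ψ q by simpa
  refine hS.induction_on (p := fun A => ∃ N : ℝ, 0 ≤ N ∧ ∀ q ∈ A, q ∈ S → γ < g q + N * ψ q)
    ⟨0, le_rfl, by simp⟩ (fun A B hAB ⟨N, hN, hB⟩ => ⟨N, hN, fun q hq => hB q (hAB hq)⟩)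
    (fun A B ⟨N, hN, hA⟩ ⟨M, _, hB⟩ => ⟨max N M, le_max_of_le_left hN, ?_⟩) (fun q hq => ?_)
  · rintro q (hq | hq) hqS
    · nlinarith [hA q hq hqS, hψ₀ q hqS, le_max_left N M]
    · nlinarith [hB q hq hqS, hψ₀ q hqS, le_max_right N M]
  · obtain ⟨N, hN, hNq⟩ := hpt q hq
    have hev : ∀ᶠ q' in 𝓝[S] q, γ < g q' + N * ψ q' :=
      ((hg.add (continuousOn_const.mul hψ)) q hq).eventually_const_lt hNq
    exact ⟨{q' | γ < g q' + N * ψ q'}, hev, N, hN, fun q' hq' _ => hq'⟩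

/-- Doubling of variables: a minimum of `g + h` is approximated by minima of the decoupled function
`g q + h q' + N * d q q'`, where `d` measures the distance between the two variables. -/
theorem exists_isMinOn_add_mul_prod {α : Type*} [PseudoMetricSpace α] {S V : Set α}
    (hS : IsCompact S) (hV : IsOpen V) {g h : α → ℝ} (hg : ContinuousOn g S)
    (hh : ContinuousOn h S) {q₀ : α} (hq₀ : q₀ ∈ S)
    (hmin : ∀ q ∈ S \ V, g q₀ + h q₀ < g q + h q) {d : α × α → ℝ} (hd : Continuous d)
    (hd₀ : ∀ q, 0 ≤ d q) (hd_eq : ∀ z, d z = 0 ↔ z.1 = z.2)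
    {ρ : ℝ} (hρ : 0 < ρ) :
    ∃ N : ℝ, 0 ≤ N ∧ ∃ q ∈ S ∩ V, ∃ q' ∈ S ∩ V, dist q q' < ρ ∧
      IsMinOn (fun z : α × α => g z.1 + h z.2 + N * d z) (S ×ˢ S) (q, q') := by
  set W : Set (α × α) := V ×ˢ V ∩ {z | dist z.1 z.2 < ρ}
  have hWo : IsOpen W := (hV.prod hV).inter (isOpen_lt (by fun_prop) continuous_const)
  have hcont : ContinuousOn (fun z : α × α => g z.1 + h z.2) (S ×ˢ S) :=
    (hg.comp continuousOn_fst fun z hz => hz.1).add (hh.comp continuousOn_snd fun z hz => hz.2)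
  obtain ⟨N, hN, hfar⟩ : ∃ N : ℝ, 0 ≤ N ∧ ∀ z ∈ S ×ˢ S \ W,
      g q₀ + h q₀ < g z.1 + h z.2 + N * d z := by
    refine exists_forall_lt_add_mul ((hS.prod hS).diff hWo) (hcont.mono sdiff_subset)
      hd.continuousOn (fun z _ => hd₀ z) ?_
    rintro ⟨q, q'⟩ ⟨hz, hzW⟩ hz₀
    obtain rfl : q = q' := (hd_eq (q, q')).1 hz₀
    exact hmin q ⟨hz.1, fun hqV => hzW ⟨⟨hqV, hqV⟩, by simpa using hρ⟩⟩
  obtain ⟨z, hzS, hz⟩ := (hS.prod hS).exists_isMinOn ⟨(q₀, q₀), hq₀, hq₀⟩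
    (hcont.add (continuousOn_const.mul hd.continuousOn) :
      ContinuousOn (fun z : α × α => g z.1 + h z.2 + N * d z) (S ×ˢ S))
  have hzW : z ∈ W := by
    by_contra hzW
    have hle : g z.1 + h z.2 + N * d z ≤ g q₀ + h q₀ + N * d (q₀, q₀) :=
      hz (show (q₀, q₀) ∈ S ×ˢ S from ⟨hq₀, hq₀⟩)
    rw [(hd_eq (q₀, q₀)).2 rfl, mul_zero, add_zero] at hle
    exact (hfar z ⟨hzS, hzW⟩).not_ge hle
  exact ⟨N, hN, z.1, ⟨hzS.1, hzW.1.1⟩, z.2, ⟨hzS.2, hzW.1.2⟩, hzW.2, hz⟩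

end Penalization

section Subgradients

variable {n : ℕ} {Φ : ℝ → EuclideanSpace ℝ (Fin n) → ℝ} {t : ℝ} {x : EuclideanSpace ℝ (Fin n)}
  {ζ : ℝ × EuclideanSpace ℝ (Fin n)}

theorem mem_proxSubgrad_of_isLocalMinOn_add_sq {c : ℝ} (hc : 0 ≤ c)
    {q : ℝ × EuclideanSpace ℝ (Fin n)}
    (h : IsLocalMinOn (fun q' : ℝ × EuclideanSpace ℝ (Fin n) =>
      Φ q'.1 q'.2 + c * ((q'.1 - q.1) ^ 2 + ‖q'.2 - q.2‖ ^ 2)) (Ici (0 : ℝ) ×ˢ univ) (t, x)) :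
    (2 * c) • (q - (t, x)) ∈ proxSubgrad Φ t x := by
  refine ⟨c + 1, by positivity, _, h, fun q' hq' => ?_⟩
  have hle : Φ t x + c * ((t - q.1) ^ 2 + ‖x - q.2‖ ^ 2) ≤
      Φ q'.1 q'.2 + c * ((q'.1 - q.1) ^ 2 + ‖q'.2 - q.2‖ ^ 2) := hq'
  have hexp : ‖q'.2 - q.2‖ ^ 2 =
      ‖x - q.2‖ ^ 2 - 2 * inner ℝ (q.2 - x) (q'.2 - x) + ‖q'.2 - x‖ ^ 2 := by
    rw [← sub_sub_sub_cancel_right q'.2 q.2 x, norm_sub_sq_real, norm_sub_rev q.2 x,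
      real_inner_comm]
    ring
  simp only [Prod.smul_fst, Prod.smul_snd, Prod.fst_sub, Prod.snd_sub, smul_eq_mul,
    real_inner_smul_left, Real.norm_eq_abs, sq_abs]
  rw [hexp] at hle
  nlinarith [sq_nonneg (q'.1 - t), sq_nonneg ‖q'.2 - x‖]

/-- Fuzzy sum rule. -/
theorem exists_mem_proxSubgrad_neg_mem_proxSubgrad {g h : ℝ → EuclideanSpace ℝ (Fin n) → ℝ}
    {S V : Set (ℝ × EuclideanSpace ℝ (Fin n))} (hS : IsCompact S) (hV : IsOpen V)
    (hVS : V ∩ Ici (0 : ℝ) ×ˢ univ ⊆ S) (hg : ContinuousOn (fun q => g q.1 q.2) S)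
    (hh : ContinuousOn (fun q => h q.1 q.2) S) {q₀ : ℝ × EuclideanSpace ℝ (Fin n)} (hq₀ : q₀ ∈ S)
    (hmin : ∀ q ∈ S \ V, g q₀.1 q₀.2 + h q₀.1 q₀.2 < g q.1 q.2 + h q.1 q.2) {ρ : ℝ} (hρ : 0 < ρ) :
    ∃ q ∈ S ∩ V, ∃ q' ∈ S ∩ V, dist q q' < ρ ∧
      ∃ ζ ∈ proxSubgrad g q.1 q.2, -ζ ∈ proxSubgrad h q'.1 q'.2 := by
  have hd_eq : ∀ z : (ℝ × EuclideanSpace ℝ (Fin n)) × (ℝ × EuclideanSpace ℝ (Fin n)),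
      (z.1.1 - z.2.1) ^ 2 + ‖z.1.2 - z.2.2‖ ^ 2 = 0 ↔ z.1 = z.2 := fun z => by
    rw [add_eq_zero_iff_of_nonneg (sq_nonneg _) (sq_nonneg _), sq_eq_zero_iff, sq_eq_zero_iff,
      norm_eq_zero, sub_eq_zero, sub_eq_zero, Prod.ext_iff]
  obtain ⟨N, hN, q, hq, q', hq', hdist, hqq'⟩ := exists_isMinOn_add_mul_prod hS hV hg hh hq₀ hmin
    (by fun_prop) (fun z => by positivity) hd_eq hρ
  have hnhds : ∀ p ∈ V, S ∈ 𝓝[Ici (0 : ℝ) ×ˢ univ] p := fun p hp =>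
    mem_of_superset (inter_mem (mem_nhdsWithin_of_mem_nhds (hV.mem_nhds hp)) self_mem_nhdsWithin)
      hVS
  refine ⟨q, hq, q', hq', hdist, (2 * N) • (q' - q),
    mem_proxSubgrad_of_isLocalMinOn_add_sq hN ?_, ?_⟩
  · filter_upwards [hnhds q hq.2] with p hp
    have := isMinOn_iff.1 hqq' (p, q') (mk_mem_prod hp hq'.1)
    linarith
  · rw [← smul_neg, neg_sub]
    refine mem_proxSubgrad_of_isLocalMinOn_add_sq hN ?_
    filter_upwards [hnhds q' hq'.2] with p hp
    have := isMinOn_iff.1 hqq' (q, p) (mk_mem_prod hq.1 hp)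
    rw [sub_sq_comm p.1, norm_sub_rev p.2, sub_sq_comm q'.1, norm_sub_rev q'.2]
    linarith

theorem add_mem_proxSubgrad_of_sub_affine {η q : ℝ × EuclideanSpace ℝ (Fin n)}
    (h : ζ ∈ proxSubgrad (fun s y => Φ s y - (η.1 * s + inner ℝ η.2 y)) q.1 q.2) :
    ζ + η ∈ proxSubgrad Φ q.1 q.2 := by
  obtain ⟨σ, hσ, U, hU, hUq⟩ := h
  refine ⟨σ, hσ, U, hU, fun p hp => ?_⟩
  have := hUq p hp
  simp only [Prod.fst_add, Prod.snd_add, inner_add_left, inner_sub_right] at this ⊢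
  linarith

theorem mem_proxSubgrad_of_time_reversal {T : ℝ} (ht : 0 < t)
    (h : ζ ∈ proxSubgrad (fun s y => Φ (T - s) y) t x) :
    (-ζ.1, ζ.2) ∈ proxSubgrad Φ (T - t) x := by
  obtain ⟨σ, hσ, U, hU, hUq⟩ := h
  have hrev : Tendsto (fun q : ℝ × EuclideanSpace ℝ (Fin n) => (T - q.1, q.2)) (𝓝 (T - t, x))
      (𝓝 (t, x)) := by
    have := (by fun_prop : Continuous fun q : ℝ × EuclideanSpace ℝ (Fin n) => (T - q.1, q.2))
    simpa using this.tendsto (T - t, x)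
  have hU' : U ∈ 𝓝 (t, x) := by
    rwa [nhdsWithin_eq_nhds.2 (prod_mem_nhds (Ici_mem_nhds ht) univ_mem)] at hU
  refine ⟨σ, hσ, _, mem_nhdsWithin_of_mem_nhds (hrev hU'), fun q hq => ?_⟩
  have hle := hUq _ hq
  simp only [sub_sub_cancel] at hle
  rw [show T - q.1 - t = -(q.1 - (T - t)) by ring, norm_neg] at hle
  linarith

end Subgradients

section Dini

variable {n : ℕ} {Φ : ℝ → EuclideanSpace ℝ (Fin n) → ℝ} {t : ℝ} {x : EuclideanSpace ℝ (Fin n)}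
  {ζ : ℝ × EuclideanSpace ℝ (Fin n)}

theorem neg_mem_diniSubgrad_neg_iff :
    -ζ ∈ diniSubgrad (fun s y => -Φ s y) t x ↔ ζ ∈ diniSupergrad Φ t x := by
  have hdini : ∀ u v, lowerDini (fun s y => -Φ s y) t x u v = -upperDini Φ t x u v := by
    intro u v
    rw [lowerDini, upperDini, ← EReal.liminf_neg]
    congr 1
    funext q
    rw [Pi.neg_apply, ← EReal.coe_neg]
    congr 1
    ring
  refine forall_congr' fun u => forall_congr' fun v => ?_
  rw [hdini, EReal.le_neg, ← EReal.coe_neg, Prod.fst_neg, Prod.snd_neg, inner_neg_right]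
  ring_nf

theorem tendsto_diniFilter (u : ℝ) (v : EuclideanSpace ℝ (Fin n)) :
    Tendsto (fun q : ℝ × EuclideanSpace ℝ (Fin n) => (t + q.1 * u, x + q.1 • q.2))
      (diniFilter t u v) (𝓝[Ici (0 : ℝ) ×ˢ univ] (t, x)) := by
  refine tendsto_nhdsWithin_iff.2 ⟨?_, ?_⟩
  · have h : Tendsto (fun q : ℝ × EuclideanSpace ℝ (Fin n) => (t + q.1 * u, x + q.1 • q.2))
        (𝓝 (0, v)) (𝓝 (t + 0 * u, x + (0 : ℝ) • v)) :=
      Continuous.tendsto (by fun_prop) _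
    rw [zero_mul, add_zero, zero_smul, add_zero, nhds_prod_eq] at h
    exact h.mono_left (inf_le_left.trans (prod_mono nhdsWithin_le_nhds le_rfl))
  · filter_upwards [mem_inf_of_right (mem_principal_self _)] with q hq
    exact ⟨hq, trivial⟩

theorem proxSubgrad_subset_diniSubgrad : proxSubgrad Φ t x ⊆ diniSubgrad Φ t x := by
  rintro ⟨a, p⟩ ⟨σ, -, U, hU, hUp⟩ u v
  have hquad : Tendsto (fun q : ℝ × EuclideanSpace ℝ (Fin n) =>
      u * a + inner ℝ q.2 p - σ * q.1 * (u ^ 2 + ‖q.2‖ ^ 2)) (𝓝[>] 0 ×ˢ 𝓝 v)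
      (𝓝 (u * a + inner ℝ v p)) := by
    have h := (by fun_prop : Continuous fun q : ℝ × EuclideanSpace ℝ (Fin n) =>
      u * a + inner ℝ q.2 p - σ * q.1 * (u ^ 2 + ‖q.2‖ ^ 2)).tendsto (0, v)
    rw [mul_zero, zero_mul, sub_zero, nhds_prod_eq] at h
    exact h.mono_left (prod_mono nhdsWithin_le_nhds le_rfl)
  refine (le_liminf_iff).2 fun y hy => ?_
  filter_upwards [(tendsto_diniFilter u v).eventually hU,
    mem_inf_of_left (prod_mem_prod self_mem_nhdsWithin univ_mem),
    (((continuous_coe_real_ereal.tendsto _).comp hquad).eventually_const_lt hy).filter_mono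
      inf_le_left] with q hq hq₀ hyq
  refine hyq.trans_le (EReal.coe_le_coe_iff.2 ?_)
  rw [le_div_iff₀ hq₀.1]
  have hle := hUp _ hq
  simp only [add_sub_cancel_left, norm_mul, norm_smul, mul_pow, Real.norm_eq_abs, sq_abs,
    inner_smul_right] at hle
  dsimp only
  rw [real_inner_comm]
  linarith

theorem mul_add_inner_le_of_mem_diniSubgrad (hζ : ζ ∈ diniSubgrad Φ t x)
    {Y : ℝ → EuclideanSpace ℝ (Fin n)} {v : EuclideanSpace ℝ (Fin n)} {u c : ℝ} (hY₀ : Y 0 = x)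
    (hY : HasDerivWithinAt Y v (Ioi 0) 0)
    (hle : ∀ᶠ r in 𝓝[>] (0 : ℝ), 0 ≤ t + r * u ∧ Φ (t + r * u) (Y r) ≤ Φ t x + c * r) :
    u * ζ.1 + inner ℝ ζ.2 v ≤ c := by
  by_contra! hlt
  have hdini : (c : EReal) < lowerDini Φ t x u v := by
    refine lt_of_lt_of_le (EReal.coe_lt_coe_iff.2 ?_) (hζ u v)
    rwa [real_inner_comm]
  have hslope : Tendsto (fun r => (r, slope Y 0 r)) (𝓝[>] (0 : ℝ)) (diniFilter t u v) := by
    refine tendsto_inf.2 ⟨tendsto_id.prodMk ?_, tendsto_principal.2 (hle.mono fun r hr => hr.1)⟩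
    exact (hasDerivWithinAt_iff_tendsto_slope' (lt_irrefl _)).1 hY
  obtain ⟨r, hr, ⟨-, hrle⟩, hrpos⟩ := ((hslope.eventually (eventually_lt_of_lt_liminf hdini)).and
    (hle.and self_mem_nhdsWithin)).exists
  replace hrpos : 0 < r := hrpos
  have hYr : x + r • slope Y 0 r = Y r := by
    have := sub_smul_slope Y 0 r
    rw [sub_zero, hY₀, vsub_eq_sub] at this
    rw [this, add_sub_cancel]
  rw [EReal.coe_lt_coe_iff, lt_div_iff₀ hrpos, hYr] at hr
  linarith

theorem le_mul_add_inner_of_mem_diniSupergrad (hζ : ζ ∈ diniSupergrad Φ t x)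
    {Y : ℝ → EuclideanSpace ℝ (Fin n)} {v : EuclideanSpace ℝ (Fin n)} {u c : ℝ} (hY₀ : Y 0 = x)
    (hY : HasDerivWithinAt Y v (Ioi 0) 0)
    (hle : ∀ᶠ r in 𝓝[>] (0 : ℝ), 0 ≤ t + r * u ∧ Φ t x ≤ Φ (t + r * u) (Y r) + c * r) :
    -c ≤ u * ζ.1 + inner ℝ ζ.2 v := by
  have := mul_add_inner_le_of_mem_diniSubgrad (neg_mem_diniSubgrad_neg_iff.2 hζ) hY₀ hY (u := u)
    (c := c) (hle.mono fun r hr => ⟨hr.1, by linarith [hr.2]⟩)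
  rw [Prod.fst_neg, Prod.snd_neg, inner_neg_left] at this
  linarith

theorem eventually_forall_mul_le_of_mem_diniSubgrad (ht : 0 ≤ t) (hζ : ζ ∈ diniSubgrad Φ t x)
    {C : Set (EuclideanSpace ℝ (Fin n))} (hC : IsCompact C) {ε : ℝ} (hε : 0 < ε) :
    ∀ᶠ r in 𝓝[>] (0 : ℝ), ∀ w ∈ C,
      r * (ζ.1 + inner ℝ ζ.2 w - ε) ≤ Φ (t + r) (x + r • w) - Φ t x := by
  have hloc : ∀ v ∈ C, {q : ℝ × EuclideanSpace ℝ (Fin n) |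
      q.1 * (ζ.1 + inner ℝ ζ.2 q.2 - ε) ≤ Φ (t + q.1) (x + q.1 • q.2) - Φ t x} ∈
        𝓝[>] (0 : ℝ) ×ˢ 𝓝 v := by
    intro v _
    have hdini : ((ζ.1 + inner ℝ ζ.2 v - ε / 2 : ℝ) : EReal) < lowerDini Φ t x 1 v := by
      refine lt_of_lt_of_le (EReal.coe_lt_coe_iff.2 ?_) (hζ 1 v)
      rw [real_inner_comm]
      linarith
    have hquot := eventually_lt_of_lt_liminf hdini
    rw [diniFilter, eventually_inf_principal] at hquot
    have hcont : ∀ᶠ w in 𝓝 v, inner ℝ ζ.2 w < inner ℝ ζ.2 v + ε / 2 :=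
      (by fun_prop : Continuous fun w => inner ℝ ζ.2 w).continuousAt.eventually_lt_const
        (by linarith)
    filter_upwards [hquot, prod_mem_prod self_mem_nhdsWithin hcont] with q hq ⟨hpos, hq₂⟩
    replace hpos : 0 < q.1 := hpos
    replace hq₂ : inner ℝ ζ.2 q.2 < inner ℝ ζ.2 v + ε / 2 := hq₂
    have hlt := EReal.coe_lt_coe_iff.1 (hq (show (0 : ℝ) ≤ t + q.1 * 1 by linarith))
    rw [lt_div_iff₀ hpos, mul_one] at hlt
    nlinarith
  obtain ⟨A, hA, B, hB, hAB⟩ := mem_prod_iff.1 (hC.mem_prod_nhdsSet_of_forall hloc)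
  filter_upwards [hA] with r hr w hw
  exact hAB (mk_mem_prod hr (subset_of_mem_nhdsSet hB hw))

end Dini

section ConePenalty

variable {E : Type*} [NormedAddCommGroup E] {b t : ℝ} {x : E}

/-- The excess of `‖y - x‖` over `b * (s - t)`: it vanishes exactly on the forward cone of speed `b`
with apex `(t, x)`. -/
def conePenalty (b t : ℝ) (x : E) (q : ℝ × E) : ℝ :=
  max 0 (‖q.2 - x‖ - b * (q.1 - t))

theorem continuous_conePenalty : Continuous (conePenalty b t x) := by
  unfold conePenalty
  fun_prop

theorem conePenalty_nonneg (q : ℝ × E) : 0 ≤ conePenalty b t x q :=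
  le_max_left _ _

theorem conePenalty_eq_zero_iff {q : ℝ × E} :
    conePenalty b t x q = 0 ↔ ‖q.2 - x‖ ≤ b * (q.1 - t) := by
  rw [conePenalty, max_eq_left_iff, sub_nonpos]

variable [NormedSpace ℝ E]

theorem conePenalty_add_smul_le {s r : ℝ} (hr : 0 ≤ r) {y w : E} (hw : ‖w‖ ≤ b) :
    conePenalty b t x (s + r, y + r • w) ≤ conePenalty b t x (s, y) := by
  refine max_le_max_left 0 ?_
  have hnorm : ‖y + r • w - x‖ ≤ ‖y - x‖ + r * b := by
    rw [add_sub_right_comm]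
    refine (norm_add_le _ _).trans ?_
    rw [norm_smul, Real.norm_of_nonneg hr]
    gcongr
  linarith

theorem exists_forall_lt_add_conePenalty [ProperSpace E] {D : Set (ℝ × E)} (hD : IsClosed D)
    {r : ℝ} (hb : 0 < b) (hr : 0 < r) {g : ℝ × E → ℝ}
    (hg : ContinuousOn g D) {γ : ℝ} (hend : ∀ w ∈ Metric.closedBall 0 b, γ < g (t + r, x + r • w)) :
    ∃ N : ℝ, 0 ≤ N ∧ ∀ q ∈ ((Metric.closedBall t r ×ˢ Metric.closedBall x ((b + 1) * r)) ∩ D) \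
      (Metric.ball t r ×ˢ Metric.ball x ((b + 1) * r)), γ < g q + N * conePenalty b t x q := by
  refine exists_forall_lt_add_mul
    ((((isCompact_closedBall t r).prod (isCompact_closedBall x ((b + 1) * r))).inter_right hD).diff
      (Metric.isOpen_ball.prod Metric.isOpen_ball))
    (hg.mono fun q hq => hq.1.2) continuous_conePenalty.continuousOn
    (fun q _ => conePenalty_nonneg q) ?_
  rintro ⟨s, y⟩ ⟨⟨⟨hs, -⟩, -⟩, hV⟩ hcone
  rw [conePenalty_eq_zero_iff] at hcone
  simp only [Metric.mem_closedBall, dist_eq_norm, mem_prod, Metric.mem_ball] at hs hV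
  have hts : 0 ≤ s - t := nonneg_of_mul_nonneg_right ((norm_nonneg _).trans hcone) hb
  rw [Real.norm_of_nonneg hts] at hs hV
  obtain rfl : s = t + r := by
    by_contra hne
    have hsr : s - t < r := hs.lt_of_ne fun h => hne (by linarith)
    exact hV ⟨hsr, by nlinarith⟩
  rw [add_sub_cancel_left] at hcone
  have hw : r⁻¹ • (y - x) ∈ Metric.closedBall 0 b := by
    rwa [mem_closedBall_zero_iff, norm_smul, norm_inv, Real.norm_of_nonneg hr.le,
      inv_mul_le_iff₀ hr, mul_comm]
  simpa [smul_inv_smul₀ hr.ne'] using hend _ hw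

end ConePenalty

section DiniApproximation

variable {n : ℕ} {Φ : ℝ → EuclideanSpace ℝ (Fin n) → ℝ} {t : ℝ} {x : EuclideanSpace ℝ (Fin n)}
  {ζ : ℝ × EuclideanSpace ℝ (Fin n)}

theorem neg_le_of_neg_mem_proxSubgrad_conePenalty {ε N b s : ℝ} {y : EuclideanSpace ℝ (Fin n)}
    (hN : 0 ≤ N) (hs : 0 ≤ s)
    (hζ : -ζ ∈ proxSubgrad (fun s y => ε * s + N * conePenalty b t x (s, y)) s y)
    {w : EuclideanSpace ℝ (Fin n)} (hw : ‖w‖ ≤ b) : -ε ≤ ζ.1 + inner ℝ ζ.2 w := by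
  have hder : HasDerivWithinAt (fun r : ℝ => y + r • w) w (Ioi 0) 0 := by
    simpa using ((hasDerivAt_id (0 : ℝ)).smul_const w).const_add y |>.hasDerivWithinAt
  have hle := mul_add_inner_le_of_mem_diniSubgrad (proxSubgrad_subset_diniSubgrad hζ) (u := 1)
    (c := ε) (by simp) hder (by
      filter_upwards [self_mem_nhdsWithin] with r hr
      replace hr : 0 < r := hr
      have := mul_le_mul_of_nonneg_left (conePenalty_add_smul_le (t := t) (x := x) (s := s) (y := y)
        hr.le hw) hN
      rw [mul_one]
      constructor <;> linarith)
  rw [Prod.fst_neg, Prod.snd_neg, inner_neg_left] at hle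
  linarith

theorem exists_mem_proxSubgrad_forall_neg_le
    (hΦ : ContinuousOn (fun q : ℝ × EuclideanSpace ℝ (Fin n) => Φ q.1 q.2) (Ici (0 : ℝ) ×ˢ univ))
    (ht : 0 ≤ t) {b ε r : ℝ} (hb : 0 < b) (hr : 0 < r)
    (hend : ∀ w ∈ Metric.closedBall 0 b, Φ t x < Φ (t + r) (x + r • w) + ε * r) :
    ∃ q ∈ (Metric.ball t r ×ˢ Metric.ball x ((b + 1) * r)) ∩ Ici (0 : ℝ) ×ˢ univ,
      ∃ ζ ∈ proxSubgrad Φ q.1 q.2, ∀ w, ‖w‖ ≤ b → -ε ≤ ζ.1 + inner ℝ ζ.2 w := by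
  have hD : IsClosed (Ici (0 : ℝ) ×ˢ (univ : Set (EuclideanSpace ℝ (Fin n)))) :=
    isClosed_Ici.prod isClosed_univ
  have hΦε : ContinuousOn (fun q : ℝ × EuclideanSpace ℝ (Fin n) => Φ q.1 q.2 + ε * q.1)
      (Ici (0 : ℝ) ×ˢ univ) := hΦ.add (by fun_prop)
  obtain ⟨N, hN, hpen⟩ := exists_forall_lt_add_conePenalty hD hb hr hΦε (t := t)
    (x := x) (γ := Φ t x + ε * t) fun w hw => by linarith [hend w hw]
  obtain ⟨q, ⟨⟨-, hqD⟩, hqV⟩, q', ⟨⟨-, hq'D⟩, -⟩, -, ζ, hζ, hζ_neg⟩ :=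
    exists_mem_proxSubgrad_neg_mem_proxSubgrad
      (h := fun s y => ε * s + N * conePenalty b t x (s, y)) (q₀ := (t, x))
      (((isCompact_closedBall t r).prod (isCompact_closedBall x ((b + 1) * r))).inter_right hD)
      (Metric.isOpen_ball.prod Metric.isOpen_ball)
      (inter_subset_inter_left _ (prod_mono Metric.ball_subset_closedBall
        Metric.ball_subset_closedBall))
      (hΦ.mono inter_subset_right)
      ((by fun_prop : ContinuousOn (fun q : ℝ × EuclideanSpace ℝ (Fin n) => ε * q.1) _).add
        (continuous_const.mul continuous_conePenalty).continuousOn)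
      ⟨⟨Metric.mem_closedBall_self hr.le, Metric.mem_closedBall_self (by positivity)⟩, ht, trivial⟩
      (fun q hq => by
        have := hpen q hq
        rw [conePenalty_eq_zero_iff.2 (by simp), mul_zero, add_zero]
        linarith) one_pos
  exact ⟨q, ⟨hqV, hqD⟩, ζ, hζ, fun w hw =>
    neg_le_of_neg_mem_proxSubgrad_conePenalty hN hq'D.1 hζ_neg hw⟩

theorem frequently_exists_mem_proxSubgrad_le
    (hΦ : ContinuousOn (fun q : ℝ × EuclideanSpace ℝ (Fin n) => Φ q.1 q.2) (Ici (0 : ℝ) ×ˢ univ))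
    (ht : 0 ≤ t) (hζ : ζ ∈ diniSubgrad Φ t x) {b ε : ℝ} (hb : 0 < b) (hε : 0 < ε) :
    ∃ᶠ q in 𝓝[Ici (0 : ℝ) ×ˢ univ] (t, x), ∃ ζ' ∈ proxSubgrad Φ q.1 q.2,
      ∀ w, ‖w‖ ≤ b → ζ.1 + inner ℝ ζ.2 w ≤ ζ'.1 + inner ℝ ζ'.2 w + ε := by
  set G : ℝ → EuclideanSpace ℝ (Fin n) → ℝ := fun s y => Φ s y - (ζ.1 * s + inner ℝ ζ.2 y)
  refine frequently_iff.2 fun {U} hU => ?_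
  obtain ⟨ρ, hρ, hρU⟩ := Metric.mem_nhdsWithin_iff.1 hU
  obtain ⟨r, hdini, hr, hrρ⟩ := ((eventually_forall_mul_le_of_mem_diniSubgrad ht hζ
    (isCompact_closedBall 0 b) (half_pos hε)).and (Ioo_mem_nhdsGT (div_pos hρ
      (by positivity : 0 < b + 1)))).exists
  obtain ⟨q, ⟨hqV, hqD⟩, ζ', hζ', hle⟩ := exists_mem_proxSubgrad_forall_neg_le (Φ := G) (x := x)
    (ε := ε) (hΦ.sub (by fun_prop)) ht hb hr fun w hw => by
      have := hdini w hw
      simp only [G, inner_add_right, real_inner_smul_right]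
      nlinarith [mul_pos hε hr]
  refine ⟨q, hρU ⟨?_, hqD⟩, ζ' + ζ, add_mem_proxSubgrad_of_sub_affine hζ', fun w hw => ?_⟩
  · rw [lt_div_iff₀ (by positivity)] at hrρ
    rw [← ball_prod_same]
    exact prod_mono (Metric.ball_subset_ball (by nlinarith)) (Metric.ball_subset_ball
      (by linarith)) hqV
  · rw [Prod.fst_add, Prod.snd_add, inner_add_left]
    linarith [hle w hw]

end DiniApproximation

section Tube

variable {E : Type*} [NormedAddCommGroup E] {X : ℝ → E} {I : Set ℝ} {R K T : ℝ}

/-- The closed tube of radius `R` about the graph of `X` over `I`. -/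
def closedTube (X : ℝ → E) (I : Set ℝ) (R : ℝ) : Set (ℝ × E) :=
  {q | q.1 ∈ I ∧ ‖q.2 - X q.1‖ ≤ R}

/-- The open tube of radius `R` about the graph of `X` over `I`. -/
def openTube (X : ℝ → E) (I : Set ℝ) (R : ℝ) : Set (ℝ × E) :=
  {q | q.1 ∈ I ∧ ‖q.2 - X q.1‖ < R}

theorem isCompact_closedTube [ProperSpace E] (hI : IsCompact I) (hX : ContinuousOn X I) :
    IsCompact (closedTube X I R) := by
  have himage : closedTube X I R =
      (fun q : ℝ × E => (q.1, X q.1 + q.2)) '' (I ×ˢ Metric.closedBall 0 R) := by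
    ext ⟨s, y⟩
    constructor
    · rintro ⟨hs, hy⟩
      exact ⟨(s, y - X s), ⟨hs, by simpa using hy⟩, by simp⟩
    · rintro ⟨⟨s', z⟩, ⟨hs', hz⟩, ⟨⟩⟩
      exact ⟨hs', by simpa using hz⟩
  rw [himage]
  refine (hI.prod (isCompact_closedBall 0 R)).image_of_continuousOn ?_
  exact continuousOn_fst.prodMk
    ((hX.comp continuousOn_fst fun q hq => hq.1).add continuousOn_snd)

theorem isOpen_openTube (hI : IsOpen I) (hX : ContinuousOn X I) : IsOpen (openTube X I R) := by
  have hdist : ContinuousOn (fun q : ℝ × E => ‖q.2 - X q.1‖) (I ×ˢ univ) :=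
    (continuousOn_snd.sub (hX.comp continuousOn_fst fun q hq => hq.1)).norm
  convert hdist.isOpen_inter_preimage (hI.prod isOpen_univ) (isOpen_Iio : IsOpen (Iio R)) using 1
  ext q
  simp [openTube]

/-- Penalty for leaving the graph of `X` over `(-∞, T]`. The exponential weight makes it
nonincreasing along backward solutions of any field that is `K`-Lipschitz in space and has `X` as a
solution. -/
noncomputable def tubePenalty (K T : ℝ) (X : ℝ → E) (q : ℝ × E) : ℝ :=
  Real.exp (K * q.1) * ‖q.2 - X q.1‖ + max 0 (q.1 - T)

theorem continuousOn_tubePenalty (hX : ContinuousOn X I) :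
    ContinuousOn (tubePenalty K T X) (I ×ˢ univ) := by
  have hdist : ContinuousOn (fun q : ℝ × E => ‖q.2 - X q.1‖) (I ×ˢ univ) :=
    (continuousOn_snd.sub (hX.comp continuousOn_fst fun q hq => hq.1)).norm
  exact (ContinuousOn.mul (by fun_prop) hdist).add (by fun_prop)

theorem tubePenalty_nonneg (q : ℝ × E) : 0 ≤ tubePenalty K T X q := by
  unfold tubePenalty
  positivity

theorem tubePenalty_eq_zero_iff {q : ℝ × E} :
    tubePenalty K T X q = 0 ↔ q.2 = X q.1 ∧ q.1 ≤ T := by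
  rw [tubePenalty, add_eq_zero_iff_of_nonneg (by positivity) (le_max_left _ _), max_eq_left_iff,
    mul_eq_zero_iff_left (Real.exp_pos _).ne', norm_eq_zero, sub_eq_zero, sub_nonpos]

theorem tubePenalty_add_le (s : ℝ) (y z : E) :
    tubePenalty K T X (s, y + z) ≤ tubePenalty K T X (s, y) + Real.exp (K * s) * ‖z‖ := by
  have hnorm : ‖y + z - X s‖ ≤ ‖y - X s‖ + ‖z‖ := by
    rw [add_sub_right_comm]
    exact norm_add_le _ _
  have := mul_le_mul_of_nonneg_left hnorm (Real.exp_pos (K * s)).le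
  simp only [tubePenalty]
  linarith

theorem exists_forall_lt_add_tubePenalty [ProperSpace E] {t T₁ : ℝ} (hR : 0 < R)
    (hX : ContinuousOn X (Icc t T)) (hT₁ : T₁ < T) {g : ℝ × E → ℝ}
    (hg : ContinuousOn g (Icc t T ×ˢ univ)) {γ : ℝ} (hγ : γ < g (t, X t)) :
    ∃ N : ℝ, 0 ≤ N ∧ ∀ q ∈ closedTube X (Icc t T) R \ openTube X (Ioo t T) R,
      γ < g q + N * tubePenalty K T₁ X q := by
  have hsub : closedTube X (Icc t T) R \ openTube X (Ioo t T) R ⊆ Icc t T ×ˢ univ :=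
    fun q hq => ⟨hq.1.1, trivial⟩
  refine exists_forall_lt_add_mul ((isCompact_closedTube isCompact_Icc hX).diff
    (isOpen_openTube isOpen_Ioo (hX.mono Ioo_subset_Icc_self)))
    (hg.mono hsub) ((continuousOn_tubePenalty hX).mono hsub) (fun q _ => tubePenalty_nonneg q) ?_
  rintro ⟨s, y⟩ ⟨⟨hs, -⟩, hV⟩ hzero
  obtain ⟨rfl, hsT₁⟩ : y = X s ∧ s ≤ T₁ := tubePenalty_eq_zero_iff.1 hzero
  have hst : s = t := by
    by_contra hne
    exact hV ⟨⟨hs.1.lt_of_ne' hne, hsT₁.trans_lt hT₁⟩, by simpa using hR⟩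
  rwa [hst]

variable [NormedSpace ℝ E]

theorem tubePenalty_sub_le {s r : ℝ} (hr : 0 ≤ r) {z w : E} (hw : ‖w‖ ≤ K * ‖z‖) :
    tubePenalty K T X (s - r, X (s - r) + (z - r • w)) ≤ tubePenalty K T X (s, X s + z) := by
  simp only [tubePenalty, add_sub_cancel_left]
  refine add_le_add ?_ (max_le_max_left 0 (by linarith))
  calc Real.exp (K * (s - r)) * ‖z - r • w‖
      ≤ Real.exp (K * (s - r)) * ((K * r + 1) * ‖z‖) := by
        gcongr
        refine (norm_sub_le _ _).trans ?_
        rw [norm_smul, Real.norm_of_nonneg hr]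
        nlinarith
    _ ≤ Real.exp (K * (s - r)) * (Real.exp (K * r) * ‖z‖) := by
        gcongr
        exact Real.add_one_le_exp _
    _ = Real.exp (K * s) * ‖z‖ := by
        rw [← mul_assoc, ← Real.exp_add]
        ring_nf

end Tube

section Monotonicity

variable {n : ℕ} {Φ : ℝ → EuclideanSpace ℝ (Fin n) → ℝ} {X : ℝ → EuclideanSpace ℝ (Fin n)}
  {ζ : ℝ × EuclideanSpace ℝ (Fin n)} {K T c N s : ℝ} {y : EuclideanSpace ℝ (Fin n)}

theorem norm_snd_le_of_neg_mem_proxSubgrad_tubePenalty (hN : 0 ≤ N) (hs : 0 ≤ s)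
    (hζ : -ζ ∈ proxSubgrad (fun s y => c * s + N * tubePenalty K T X (s, y)) s y) :
    ‖ζ.2‖ ≤ N * Real.exp (K * s) := by
  have hder : HasDerivWithinAt (fun r : ℝ => y + r • -ζ.2) (-ζ.2) (Ioi 0) 0 := by
    simpa using ((hasDerivAt_id (0 : ℝ)).smul_const (-ζ.2)).const_add y |>.hasDerivWithinAt
  have hle := mul_add_inner_le_of_mem_diniSubgrad (proxSubgrad_subset_diniSubgrad hζ) (u := 0)
    (c := N * Real.exp (K * s) * ‖ζ.2‖) (by simp) hder (by
      filter_upwards [self_mem_nhdsWithin] with r hr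
      have hpen := tubePenalty_add_le (K := K) (T := T) (X := X) s y (r • -ζ.2)
      rw [norm_smul, norm_neg, Real.norm_of_nonneg (le_of_lt hr)] at hpen
      rw [mul_zero, add_zero]
      exact ⟨hs, by nlinarith⟩)
  rw [zero_mul, zero_add, Prod.snd_neg, real_inner_self_eq_norm_sq, norm_neg] at hle
  by_contra! hlt
  have : 0 < ‖ζ.2‖ := lt_of_le_of_lt (by positivity) hlt
  nlinarith

theorem add_inner_le_of_neg_mem_proxSubgrad_tubePenalty (hN : 0 ≤ N) (hs : 0 < s)
    (hζ : -ζ ∈ proxSubgrad (fun s y => c * s + N * tubePenalty K T X (s, y)) s y)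
    {v w : EuclideanSpace ℝ (Fin n)} (hX : HasDerivAt X v s) (hvw : ‖w - v‖ ≤ K * ‖y - X s‖) :
    ζ.1 + inner ℝ ζ.2 w ≤ -c := by
  have hder : HasDerivWithinAt (fun r : ℝ => X (s - r) + (y - X s - r • (w - v)))
      (-w) (Ioi 0) 0 := by
    have hX' : HasDerivAt (fun r : ℝ => X (s - r)) (-v) 0 :=
      HasDerivAt.comp_const_sub s 0 (by rwa [sub_zero])
    have := hX'.add (((hasDerivAt_id (0 : ℝ)).smul_const (w - v)).const_sub (y - X s))
    rw [one_smul, neg_sub, neg_add_eq_sub, sub_sub_cancel_left] at this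
    exact this.hasDerivWithinAt
  have hle := mul_add_inner_le_of_mem_diniSubgrad (proxSubgrad_subset_diniSubgrad hζ) (u := -1)
    (c := -c) (by simp) hder (by
      filter_upwards [Ioo_mem_nhdsGT hs] with r hr
      have hpen := tubePenalty_sub_le (T := T) (X := X) (s := s) hr.1.le hvw
      rw [add_sub_cancel] at hpen
      rw [mul_neg_one, ← sub_eq_add_neg]
      exact ⟨by linarith [hr.2], by nlinarith⟩)
  rw [Prod.fst_neg, Prod.snd_neg, inner_neg_neg] at hle
  linarith

variable {t c' R : ℝ} {F : ℝ → EuclideanSpace ℝ (Fin n) → EuclideanSpace ℝ (Fin n)} {K : NNReal}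

theorem exists_mem_proxSubgrad_of_add_mul_lt (ht : 0 ≤ t)
    (hΦ : ContinuousOn (fun q : ℝ × EuclideanSpace ℝ (Fin n) => Φ q.1 q.2) (Icc t T ×ˢ univ))
    (hFK : ∀ s ∈ Ioo t T, LipschitzWith K (F s)) (hX : ContinuousOn X (Icc t T))
    (hXF : ∀ s ∈ Ioo t T, HasDerivAt X (F s (X s)) s) (hR : 0 < R) {T₁ : ℝ} (hT₁ : T₁ ∈ Ioo t T)
    (hlt : Φ T₁ (X T₁) + c * (T₁ - t) < Φ t (X t)) :
    ∃ M : ℝ, 0 ≤ M ∧ ∀ ρ > 0, ∃ q ∈ openTube X (Ioo t T) R, ∃ q' ∈ openTube X (Ioo t T) R,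
      dist q q' < ρ ∧ ∃ ζ ∈ proxSubgrad Φ q.1 q.2,
        ‖ζ.2‖ ≤ M ∧ ζ.1 + inner ℝ ζ.2 (F q'.1 q'.2) ≤ -c := by
  have hsub : closedTube X (Icc t T) R ⊆ Icc t T ×ˢ univ := fun q hq => ⟨hq.1, trivial⟩
  have hΦc : ContinuousOn (fun q : ℝ × EuclideanSpace ℝ (Fin n) => Φ q.1 q.2 + c * q.1)
      (Icc t T ×ˢ univ) := hΦ.add (by fun_prop)
  obtain ⟨N, hN, hpen⟩ := exists_forall_lt_add_tubePenalty (K := K) hR hX hT₁.2 hΦc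
    (γ := Φ T₁ (X T₁) + c * T₁) (by linarith)
  have hzero : tubePenalty K T₁ X (T₁, X T₁) = 0 := tubePenalty_eq_zero_iff.2 ⟨rfl, le_rfl⟩
  refine ⟨N * Real.exp (K * T), by positivity, fun ρ hρ => ?_⟩
  obtain ⟨q, hq, q', hq', hdist, ζ, hζ, hζ_neg⟩ := exists_mem_proxSubgrad_neg_mem_proxSubgrad
    (h := fun s y => c * s + N * tubePenalty K T₁ X (s, y)) (q₀ := (T₁, X T₁))
    (isCompact_closedTube isCompact_Icc hX)
    (isOpen_openTube isOpen_Ioo (hX.mono Ioo_subset_Icc_self))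
    (fun q hq => ⟨Ioo_subset_Icc_self hq.1.1, hq.1.2.le⟩) (hΦ.mono hsub)
    ((by fun_prop : ContinuousOn (fun q : ℝ × EuclideanSpace ℝ (Fin n) => c * q.1) _).add
      (continuousOn_const.mul ((continuousOn_tubePenalty hX).mono hsub)))
    ⟨Ioo_subset_Icc_self hT₁, by simpa using hR.le⟩
    (fun q hq => by
      have := hpen q hq
      simp only [hzero]
      linarith) hρ
  have hpos : 0 < q'.1 := ht.trans_lt hq'.2.1.1
  refine ⟨q, hq.2, q', hq'.2, hdist, ζ, hζ, ?_, ?_⟩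
  · refine (norm_snd_le_of_neg_mem_proxSubgrad_tubePenalty hN hpos.le hζ_neg).trans ?_
    gcongr
    exact hq'.2.1.2.le
  · exact add_inner_le_of_neg_mem_proxSubgrad_tubePenalty hN hpos hζ_neg (hXF q'.1 hq'.2.1)
      ((hFK q'.1 hq'.2.1).norm_sub_le _ _)

theorem le_add_mul_of_forall_mem_proxSubgrad (ht : 0 ≤ t)
    (hΦ : ContinuousOn (fun q : ℝ × EuclideanSpace ℝ (Fin n) => Φ q.1 q.2) (Icc t T ×ˢ univ))
    (hF : ContinuousOn (fun q : ℝ × EuclideanSpace ℝ (Fin n) => F q.1 q.2) (Icc t T ×ˢ univ))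
    (hFK : ∀ s ∈ Ioo t T, LipschitzWith K (F s)) (hX : ContinuousOn X (Icc t T))
    (hXF : ∀ s ∈ Ioo t T, HasDerivAt X (F s (X s)) s) (hR : 0 < R)
    (hprox : ∀ q ∈ openTube X (Ioo t T) R, ∀ ζ ∈ proxSubgrad Φ q.1 q.2,
      -c ≤ ζ.1 + inner ℝ ζ.2 (F q.1 q.2)) (hc : c < c') {T₁ : ℝ} (hT₁ : T₁ ∈ Ioo t T) :
    Φ t (X t) ≤ Φ T₁ (X T₁) + c' * (T₁ - t) := by
  by_contra! hlt
  obtain ⟨M, hM, hsubgrad⟩ := exists_mem_proxSubgrad_of_add_mul_lt ht hΦ hFK hX hXF hR hT₁ hlt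
  have hcc' : 0 < (c' - c) / (M + 1) := div_pos (sub_pos.2 hc) (by positivity)
  obtain ⟨ρ, hρ, hunif⟩ := Metric.uniformContinuousOn_iff.1
    ((isCompact_closedTube (R := R) isCompact_Icc hX).uniformContinuousOn_of_continuous
      (hF.mono fun q hq => ⟨hq.1, trivial⟩)) _ hcc'
  obtain ⟨q, hq, q', hq', hdist, ζ, hζ, hζM, hupper⟩ := hsubgrad ρ hρ
  have hlower := hprox q hq ζ hζ
  have hFqq' : ‖F q.1 q.2 - F q'.1 q'.2‖ ≤ (c' - c) / (M + 1) := by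
    rw [← dist_eq_norm]
    exact (hunif q ⟨Ioo_subset_Icc_self hq.1, hq.2.le⟩ q' ⟨Ioo_subset_Icc_self hq'.1, hq'.2.le⟩
      hdist).le
  have : c' - c < c' - c := calc
    c' - c ≤ inner ℝ ζ.2 (F q.1 q.2 - F q'.1 q'.2) := by rw [inner_sub_right]; linarith
    _ ≤ M * ((c' - c) / (M + 1)) := (real_inner_le_norm _ _).trans (by gcongr)
    _ < (M + 1) * ((c' - c) / (M + 1)) := by gcongr; linarith
    _ = c' - c := by field_simp
  exact this.false

end Monotonicity

section Trajectories

theorem exists_forall_mem_Icc_hasDerivWithinAt {E : Type*} [NormedAddCommGroup E] [NormedSpace ℝ E]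
    [CompleteSpace E] {F : ℝ → E → E} {t T : ℝ} {K : NNReal} (htT : t < T)
    (hF : ContinuousOn (fun q : ℝ × E => F q.1 q.2) (Icc t T ×ˢ univ))
    (hFK : ∀ s ∈ Icc t T, LipschitzWith K (F s)) (x : E) :
    ∃ T' ∈ Ioc t T, ∃ X : ℝ → E, X t = x ∧
      ∀ s ∈ Icc t T', HasDerivWithinAt X (F s (X s)) (Icc t T') s := by
  have hFy : ∀ y, ContinuousOn (fun s => F s y) (Icc t T) := fun y =>
    hF.comp (continuousOn_id.prodMk continuousOn_const) fun s hs => ⟨hs, trivial⟩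
  obtain ⟨C, hC⟩ := isCompact_Icc.exists_bound_of_continuousOn (hFy x)
  set L : NNReal := C.toNNReal + K
  have hL : ∀ s ∈ Icc t T, ∀ y ∈ Metric.closedBall x ((1 : NNReal) : ℝ), ‖F s y‖ ≤ L := by
    intro s hs y hy
    rw [NNReal.coe_one, mem_closedBall_iff_norm] at hy
    calc ‖F s y‖ ≤ ‖F s x‖ + ‖F s y - F s x‖ := norm_le_norm_add_norm_sub' _ _
      _ ≤ C.toNNReal + K * 1 := add_le_add ((hC s hs).trans (Real.le_coe_toNNReal C))
          (((hFK s hs).norm_sub_le y x).trans (by gcongr))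
      _ = L := by rw [mul_one, NNReal.coe_add]
  set T' : ℝ := min T (t + 1 / (L + 1))
  have htT' : t < T' := lt_min htT (lt_add_of_pos_right t (by positivity))
  have hsub : Icc t T' ⊆ Icc t T := Icc_subset_Icc_right (min_le_left _ _)
  have hPL : IsPicardLindelof F ⟨t, left_mem_Icc.2 htT'.le⟩ x 1 0 L K :=
    { lipschitzOnWith := fun s hs => (hFK s (hsub hs)).lipschitzOnWith
      continuousOn := fun y _ => (hFy y).mono hsub
      norm_le := fun s hs => hL s (hsub hs)
      mul_max_le := by
        have hlen : T' - t ≤ 1 / (L + 1) := sub_le_iff_le_add'.2 (min_le_right _ _)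
        rw [sub_self, max_eq_left (sub_nonneg.2 htT'.le), NNReal.coe_zero, NNReal.coe_one, sub_zero]
        calc (L : ℝ) * (T' - t) ≤ (L + 1) * (1 / (L + 1)) := by gcongr; linarith
          _ = 1 := mul_one_div_cancel (by positivity) }
  obtain ⟨X, hXt, hX⟩ := hPL.exists_eq_forall_mem_Icc_hasDerivWithinAt₀
  exact ⟨T', ⟨htT', min_le_left _ _⟩, X, hXt, hX⟩

theorem exists_trajectory_openTube_subset {E : Type*} [NormedAddCommGroup E] [NormedSpace ℝ E]
    [CompleteSpace E] {F : ℝ → E → E} {t T : ℝ} {K : NNReal} (htT : t < T)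
    (hF : ContinuousOn (fun q : ℝ × E => F q.1 q.2) (Icc t T ×ˢ univ))
    (hFK : ∀ s ∈ Icc t T, LipschitzWith K (F s)) {x : E} {U : Set (ℝ × E)}
    (hU : U ∈ 𝓝[Ioi t ×ˢ univ] (t, x)) :
    ∃ T' ∈ Ioc t T, ∃ X : ℝ → E, X t = x ∧
      (∀ s ∈ Icc t T', HasDerivWithinAt X (F s (X s)) (Icc t T') s) ∧
      ∃ R > 0, openTube X (Ioo t T') R ⊆ U := by
  obtain ⟨S, hS, X, rfl, hX⟩ := exists_forall_mem_Icc_hasDerivWithinAt htT hF hFK x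
  have hXt := (hX t (left_mem_Icc.2 hS.1.le)).mono_of_mem_nhdsWithin (Icc_mem_nhdsGE hS.1)
  obtain ⟨ρ, hρ, hball⟩ := Metric.mem_nhdsWithin_iff.1 hU
  have hnear : {s | s ≤ S ∧ dist s t < ρ ∧ dist (X s) (X t) < ρ / 2} ∈ 𝓝[≥] t :=
    inter_mem (mem_nhdsWithin_of_mem_nhds (Iic_mem_nhds hS.1))
      (inter_mem (mem_nhdsWithin_of_mem_nhds (Metric.ball_mem_nhds t hρ))
        (hXt.continuousWithinAt (Metric.ball_mem_nhds _ (half_pos hρ))))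
  obtain ⟨T', hT', hT'near⟩ := mem_nhdsGE_iff_exists_Icc_subset.1 hnear
  have hsub : Icc t T' ⊆ Icc t S := fun s hs => ⟨hs.1, (hT'near hs).1⟩
  refine ⟨T', ⟨hT', (hT'near (right_mem_Icc.2 (le_of_lt hT'))).1.trans hS.2⟩, X, rfl,
    fun s hs => (hX s (hsub hs)).mono hsub, ρ / 2, half_pos hρ,
    fun q hq => hball ⟨?_, hq.1.1, trivial⟩⟩
  obtain ⟨-, htime, hspace⟩ := hT'near (Ioo_subset_Icc_self hq.1)
  rw [Metric.mem_ball, Prod.dist_eq]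
  refine max_lt htime ((dist_triangle _ (X q.1) _).trans_lt ?_)
  rw [dist_eq_norm q.2]
  linarith [hq.2]

variable {n : ℕ} {Φ : ℝ → EuclideanSpace ℝ (Fin n) → ℝ}
  {F : ℝ → EuclideanSpace ℝ (Fin n) → EuclideanSpace ℝ (Fin n)} {K : NNReal} {t T c c' : ℝ}
  {x : EuclideanSpace ℝ (Fin n)}

theorem exists_eventually_le_add_mul_of_eventually_proxSubgrad (ht : 0 ≤ t) (htT : t < T)
    (hΦ : ContinuousOn (fun q : ℝ × EuclideanSpace ℝ (Fin n) => Φ q.1 q.2) (Icc t T ×ˢ univ))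
    (hF : ContinuousOn (fun q : ℝ × EuclideanSpace ℝ (Fin n) => F q.1 q.2) (Icc t T ×ˢ univ))
    (hFK : ∀ s ∈ Icc t T, LipschitzWith K (F s))
    (hprox : ∀ᶠ q in 𝓝[Ioi t ×ˢ univ] (t, x), ∀ ζ ∈ proxSubgrad Φ q.1 q.2,
      -c ≤ ζ.1 + inner ℝ ζ.2 (F q.1 q.2)) (hc : c < c') :
    ∃ Y : ℝ → EuclideanSpace ℝ (Fin n), Y 0 = x ∧ HasDerivWithinAt Y (F t x) (Ioi 0) 0 ∧
      ∀ᶠ r in 𝓝[>] (0 : ℝ), Φ t x ≤ Φ (t + r) (Y r) + c' * r := by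
  obtain ⟨T', hT', X, rfl, hX, R, hR, htube⟩ := exists_trajectory_openTube_subset htT hF hFK hprox
  have hsub : Icc t T' ⊆ Icc t T := Icc_subset_Icc_right hT'.2
  have hmono : ∀ s ∈ Ioo t T', Φ t (X t) ≤ Φ s (X s) + c' * (s - t) := fun s hs =>
    le_add_mul_of_forall_mem_proxSubgrad ht (hΦ.mono (prod_mono_left hsub))
      (hF.mono (prod_mono_left hsub)) (fun s hs => hFK s (hsub (Ioo_subset_Icc_self hs)))
      (fun s hs => (hX s hs).continuousWithinAt)
      (fun s hs => (hX s (Ioo_subset_Icc_self hs)).hasDerivAt (Icc_mem_nhds hs.1 hs.2))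
      hR htube hc hs
  refine ⟨fun r => X (t + r), congrArg X (add_zero t), ?_, ?_⟩
  · have hXt : HasDerivWithinAt X (F t (X t)) (Ici t) (t + 0) := by
      rw [add_zero]
      exact (hX t (left_mem_Icc.2 hT'.1.le)).mono_of_mem_nhdsWithin (Icc_mem_nhdsGE hT'.1)
    have hshift : HasDerivWithinAt (fun r => t + r) 1 (Ioi 0) 0 :=
      ((hasDerivAt_id (0 : ℝ)).const_add t).hasDerivWithinAt
    have hmaps : MapsTo (fun r => t + r) (Ioi 0) (Ici t) := fun r hr =>
      le_add_of_nonneg_right (le_of_lt (mem_Ioi.1 hr))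
    simpa only [Function.comp_def, one_smul] using hXt.scomp 0 hshift hmaps
  · filter_upwards [Ioo_mem_nhdsGT (sub_pos.2 hT'.1)] with r hr
    have := hmono (t + r) ⟨by linarith [hr.1], by linarith [hr.2]⟩
    rwa [add_sub_cancel_left] at this

theorem exists_eventually_le_sub_mul_of_eventually_proxSubgrad (ht : 0 < t)
    (hΦ : ContinuousOn (fun q : ℝ × EuclideanSpace ℝ (Fin n) => Φ q.1 q.2) (Icc 0 t ×ˢ univ))
    (hF : ContinuousOn (fun q : ℝ × EuclideanSpace ℝ (Fin n) => F q.1 q.2) (Icc 0 t ×ˢ univ))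
    (hFK : ∀ s ∈ Icc 0 t, LipschitzWith K (F s))
    (hprox : ∀ᶠ q in 𝓝[Ioo 0 t ×ˢ univ] (t, x), ∀ ζ ∈ proxSubgrad Φ q.1 q.2,
      ζ.1 + inner ℝ ζ.2 (F q.1 q.2) ≤ c) (hc : c < c') :
    ∃ Y : ℝ → EuclideanSpace ℝ (Fin n), Y 0 = x ∧ HasDerivWithinAt Y (-F t x) (Ioi 0) 0 ∧
      ∀ᶠ r in 𝓝[>] (0 : ℝ), Φ t x ≤ Φ (t - r) (Y r) + c' * r := by
  have hmaps : MapsTo (fun q : ℝ × EuclideanSpace ℝ (Fin n) => (2 * t - q.1, q.2))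
      (Icc t (2 * t) ×ˢ univ) (Icc 0 t ×ˢ univ) := fun q hq =>
    ⟨⟨by linarith [hq.1.2], by linarith [hq.1.1]⟩, trivial⟩
  have hcont : Continuous fun q : ℝ × EuclideanSpace ℝ (Fin n) => (2 * t - q.1, q.2) := by
    fun_prop
  have htt : 2 * t - t = t := by ring
  have hrev : Tendsto (fun q : ℝ × EuclideanSpace ℝ (Fin n) => (2 * t - q.1, q.2))
      (𝓝[Ioi t ×ˢ univ] (t, x)) (𝓝[Ioo 0 t ×ˢ univ] (t, x)) := by
    refine tendsto_nhdsWithin_iff.2 ⟨?_, ?_⟩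
    · have := hcont.tendsto (t, x)
      rw [htt] at this
      exact this.mono_left nhdsWithin_le_nhds
    · filter_upwards [self_mem_nhdsWithin, nhdsWithin_le_nhds
        (prod_mem_nhds (Iio_mem_nhds (show t < 2 * t by linarith)) univ_mem)] with q hq hq'
      exact ⟨⟨sub_pos.2 hq'.1, by linarith [show t < q.1 from hq.1]⟩, trivial⟩
  have hprox' : ∀ᶠ q in 𝓝[Ioi t ×ˢ univ] (t, x),
      ∀ ζ ∈ proxSubgrad (fun s => Φ (2 * t - s)) q.1 q.2,
        -c ≤ ζ.1 + inner ℝ ζ.2 (-F (2 * t - q.1) q.2) := by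
    filter_upwards [hrev.eventually hprox, self_mem_nhdsWithin] with q hq hq' ζ hζ
    have := hq _ (mem_proxSubgrad_of_time_reversal (ht.trans hq'.1) hζ)
    rw [inner_neg_right]
    linarith
  obtain ⟨Y, hY₀, hY, hYr⟩ := exists_eventually_le_add_mul_of_eventually_proxSubgrad
    (Φ := fun s => Φ (2 * t - s)) (F := fun s y => -F (2 * t - s) y) ht.le (by linarith)
    (hΦ.comp hcont.continuousOn hmaps) (hF.comp hcont.continuousOn hmaps).neg
    (fun s hs => (hFK _ ⟨by linarith [hs.2], by linarith [hs.1]⟩).neg) hprox' hc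
  refine ⟨Y, hY₀, by simpa only [htt] using hY, hYr.mono fun r hr => ?_⟩
  rwa [htt, ← sub_sub, htt] at hr

end Trajectories

section Transport

variable {n : ℕ} {Φ : ℝ → EuclideanSpace ℝ (Fin n) → ℝ}
  {F : ℝ → EuclideanSpace ℝ (Fin n) → EuclideanSpace ℝ (Fin n)}
  {L : ℝ → EuclideanSpace ℝ (Fin n) → ℝ} {K : NNReal} {t : ℝ} {x : EuclideanSpace ℝ (Fin n)}
  {ζ : ℝ × EuclideanSpace ℝ (Fin n)}

theorem nonneg_of_mem_diniSupergrad_of_forall_mem_proxSubgrad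
    (hΦ : ContinuousOn (fun q : ℝ × EuclideanSpace ℝ (Fin n) => Φ q.1 q.2) (Ici (0 : ℝ) ×ˢ univ))
    (hF : ContinuousOn (fun q : ℝ × EuclideanSpace ℝ (Fin n) => F q.1 q.2) (Ici (0 : ℝ) ×ˢ univ))
    (hL : ContinuousOn (fun q : ℝ × EuclideanSpace ℝ (Fin n) => L q.1 q.2) (Ici (0 : ℝ) ×ˢ univ))
    (hFK : ∀ s, 0 ≤ s → LipschitzWith K (F s))
    (hprox : ∀ s, 0 < s → ∀ y, ∀ ζ ∈ proxSubgrad Φ s y, 0 ≤ ζ.1 + (inner ℝ ζ.2 (F s y) + L s y))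
    (ht : 0 ≤ t) (hζ : ζ ∈ diniSupergrad Φ t x) : 0 ≤ ζ.1 + (inner ℝ ζ.2 (F t x) + L t x) := by
  have hsub : Icc t (t + 1) ×ˢ (univ : Set (EuclideanSpace ℝ (Fin n))) ⊆ Ici (0 : ℝ) ×ˢ univ :=
    prod_mono_left fun s hs => ht.trans hs.1
  suffices ∀ c', L t x < c' → -(ζ.1 + inner ℝ ζ.2 (F t x)) ≤ c' by
    linarith [le_of_forall_gt_imp_ge_of_dense this]
  intro c' hc'
  obtain ⟨c, hLc, hcc'⟩ := exists_between hc'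
  have hnear : ∀ᶠ q in 𝓝[Ioi t ×ˢ univ] (t, x), L q.1 q.2 < c :=
    ((hL (t, x) ⟨ht, trivial⟩).eventually_lt_const hLc).filter_mono
      (nhdsWithin_mono _ (prod_mono_left fun s hs => ht.trans (le_of_lt hs)))
  obtain ⟨Y, hY₀, hY, hΦY⟩ := exists_eventually_le_add_mul_of_eventually_proxSubgrad ht
    (lt_add_one t) (hΦ.mono hsub) (hF.mono hsub) (fun s hs => hFK s (ht.trans hs.1)) (by
      filter_upwards [hnear, self_mem_nhdsWithin] with q hq hq' ζ hζ
      linarith [hprox q.1 (ht.trans_lt hq'.1) q.2 ζ hζ]) hcc'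
  have := le_mul_add_inner_of_mem_diniSupergrad hζ hY₀ hY (u := 1) (by
    filter_upwards [hΦY, self_mem_nhdsWithin] with r hr hpos
    rw [mul_one]
    exact ⟨add_nonneg ht (le_of_lt hpos), hr⟩)
  linarith

theorem nonneg_of_mem_diniSubgrad_of_forall_mem_diniSupergrad
    (hΦ : ContinuousOn (fun q : ℝ × EuclideanSpace ℝ (Fin n) => Φ q.1 q.2) (Ici (0 : ℝ) ×ˢ univ))
    (hF : ContinuousOn (fun q : ℝ × EuclideanSpace ℝ (Fin n) => F q.1 q.2) (Ici (0 : ℝ) ×ˢ univ))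
    (hL : ContinuousOn (fun q : ℝ × EuclideanSpace ℝ (Fin n) => L q.1 q.2) (Ici (0 : ℝ) ×ˢ univ))
    (hFK : ∀ s, 0 ≤ s → LipschitzWith K (F s))
    (hdini : ∀ s, 0 < s → ∀ y, ∀ ζ ∈ diniSupergrad Φ s y, 0 ≤ ζ.1 + (inner ℝ ζ.2 (F s y) + L s y))
    (ht : 0 < t) (hζ : ζ ∈ diniSubgrad Φ t x) : 0 ≤ ζ.1 + (inner ℝ ζ.2 (F t x) + L t x) := by
  have hsub : Icc 0 t ×ˢ (univ : Set (EuclideanSpace ℝ (Fin n))) ⊆ Ici (0 : ℝ) ×ˢ univ :=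
    prod_mono_left Icc_subset_Ici_self
  suffices ∀ c', L t x < c' → -(ζ.1 + inner ℝ ζ.2 (F t x)) ≤ c' by
    linarith [le_of_forall_gt_imp_ge_of_dense this]
  intro c' hc'
  obtain ⟨c, hLc, hcc'⟩ := exists_between hc'
  have hnear : ∀ᶠ q in 𝓝[Ioo 0 t ×ˢ univ] (t, x), L q.1 q.2 < c :=
    ((hL (t, x) ⟨ht.le, trivial⟩).eventually_lt_const hLc).filter_mono
      (nhdsWithin_mono _ (prod_mono_left fun s hs => le_of_lt hs.1))
  obtain ⟨Y, hY₀, hY, hΦY⟩ := exists_eventually_le_sub_mul_of_eventually_proxSubgrad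
    (Φ := fun s y => -Φ s y) ht (hΦ.mono hsub).neg (hF.mono hsub) (fun s hs => hFK s hs.1) (by
      filter_upwards [hnear, self_mem_nhdsWithin] with q hq hq' η hη
      have hηsuper : -η ∈ diniSupergrad Φ q.1 q.2 := by
        rw [← neg_mem_diniSubgrad_neg_iff, neg_neg]
        exact proxSubgrad_subset_diniSubgrad hη
      have := hdini q.1 hq'.1.1 q.2 _ hηsuper
      rw [Prod.fst_neg, Prod.snd_neg, inner_neg_left] at this
      linarith) hcc'
  have := mul_add_inner_le_of_mem_diniSubgrad hζ hY₀ hY (u := -1) (c := c') (by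
    filter_upwards [hΦY, Ioo_mem_nhdsGT ht] with r hr hrt
    rw [mul_neg_one, ← sub_eq_add_neg]
    exact ⟨sub_nonneg.2 hrt.2.le, by linarith⟩)
  rw [inner_neg_right] at this
  linarith

end Transport

section Hamiltonian

theorem eventually_forall_const_lt {X Y : Type*} [TopologicalSpace X] [TopologicalSpace Y]
    {D : Set X} {C : Set Y} (hC : IsCompact C) {g : X × Y → ℝ} (hg : ContinuousOn g (D ×ˢ univ))
    {x : X} (hx : x ∈ D) {c : ℝ} (hlt : ∀ y ∈ C, c < g (x, y)) :
    ∀ᶠ z in 𝓝[D] x, ∀ y ∈ C, c < g (z, y) := by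
  have hloc : ∀ y ∈ C, {p | c < g p} ∈ 𝓝[D] x ×ˢ 𝓝 y := fun y hy => by
    rw [← nhdsWithin_univ y, ← nhdsWithin_prod_eq]
    exact (hg (x, y) ⟨hx, trivial⟩).eventually_const_lt (hlt y hy)
  obtain ⟨A, hA, B, hB, hAB⟩ := mem_prod_iff.1 (hC.mem_prod_nhdsSet_of_forall hloc)
  filter_upwards [hA] with z hz y hy
  exact hAB (mk_mem_prod hz (subset_of_mem_nhdsSet hB hy))

theorem exists_pos_eventually_forall_norm_lt {X Y M : Type*} [TopologicalSpace X]
    [TopologicalSpace Y] [SeminormedAddCommGroup M] {D : Set X} {C : Set Y} (hC : IsCompact C)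
    {g : X × Y → M} (hg : ContinuousOn g (D ×ˢ univ)) {x : X} (hx : x ∈ D) :
    ∃ b > 0, ∀ᶠ z in 𝓝[D] x, ∀ y ∈ C, ‖g (z, y)‖ < b := by
  obtain ⟨b, hb⟩ := hC.exists_bound_of_continuousOn (f := fun y => g (x, y))
    (hg.comp (by fun_prop) fun _ _ => ⟨hx, trivial⟩)
  refine ⟨|b| + 1, by positivity, ?_⟩
  have hlt : ∀ y ∈ C, -(|b| + 1) < -‖g (x, y)‖ := fun y hy => by linarith [hb y hy, le_abs_self b]
  filter_upwards [eventually_forall_const_lt hC hg.norm.neg hx hlt] with z hz y hy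
  exact neg_lt_neg_iff.1 (hz y hy)

theorem continuousOn_uncurry_prod {A B C M : Type*} [TopologicalSpace A] [TopologicalSpace B]
    [TopologicalSpace C] [TopologicalSpace M] {I : Set A} {g : A → B → C → M}
    (hg : ContinuousOn (fun p : A × B × C => g p.1 p.2.1 p.2.2) (I ×ˢ univ)) :
    ContinuousOn (fun p : (A × B) × C => g p.1.1 p.1.2 p.2) ((I ×ˢ univ) ×ˢ univ) :=
  hg.comp (f := fun p : (A × B) × C => (p.1.1, p.1.2, p.2)) (by fun_prop)
    fun _ hp => ⟨hp.1.1, trivial⟩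

theorem continuousOn_apply_snd {A B C M : Type*} [TopologicalSpace A] [TopologicalSpace B]
    [TopologicalSpace C] [TopologicalSpace M] {I : Set A} {g : A → B → C → M}
    (hg : ContinuousOn (fun p : A × B × C => g p.1 p.2.1 p.2.2) (I ×ˢ univ)) (c : C) :
    ContinuousOn (fun q : A × B => g q.1 q.2 c) (I ×ˢ univ) :=
  hg.comp (f := fun q : A × B => (q.1, q.2, c)) (by fun_prop) fun _ hq => ⟨hq.1, trivial⟩

variable {n m : ℕ} {δ : ℝ} {l : ℝ → EuclideanSpace ℝ (Fin n) → EuclideanSpace ℝ (Fin m) → ℝ}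
  {f : ℝ → EuclideanSpace ℝ (Fin n) → EuclideanSpace ℝ (Fin m) → EuclideanSpace ℝ (Fin n)}
  {Ω : Set (EuclideanSpace ℝ (Fin m))} {Φ : ℝ → EuclideanSpace ℝ (Fin n) → ℝ}
  {t : ℝ} {x ξ : EuclideanSpace ℝ (Fin n)} {ζ : ℝ × EuclideanSpace ℝ (Fin n)}

theorem continuousOn_preHamiltonian
    (hl : ContinuousOn (fun p : ℝ × EuclideanSpace ℝ (Fin n) × EuclideanSpace ℝ (Fin m) =>
      l p.1 p.2.1 p.2.2) (Ici (0 : ℝ) ×ˢ univ))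
    (hf : ContinuousOn (fun p : ℝ × EuclideanSpace ℝ (Fin n) × EuclideanSpace ℝ (Fin m) =>
      f p.1 p.2.1 p.2.2) (Ici (0 : ℝ) ×ˢ univ)) (ξ : EuclideanSpace ℝ (Fin n)) :
    ContinuousOn (fun p : ℝ × EuclideanSpace ℝ (Fin n) × EuclideanSpace ℝ (Fin m) =>
      preHamiltonian δ l f p.1 p.2.1 ξ p.2.2) (Ici (0 : ℝ) ×ˢ univ) :=
  (continuousOn_const.inner hf).add (ContinuousOn.mul (by fun_prop) hl)

theorem le_hamiltonian_iff
    (hl : ContinuousOn (fun p : ℝ × EuclideanSpace ℝ (Fin n) × EuclideanSpace ℝ (Fin m) =>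
      l p.1 p.2.1 p.2.2) (Ici (0 : ℝ) ×ˢ univ))
    (hf : ContinuousOn (fun p : ℝ × EuclideanSpace ℝ (Fin n) × EuclideanSpace ℝ (Fin m) =>
      f p.1 p.2.1 p.2.2) (Ici (0 : ℝ) ×ˢ univ)) (hΩ : Ω.Nonempty) (hΩc : IsCompact Ω)
    (ht : 0 ≤ t) {a : ℝ} :
    a ≤ hamiltonian δ l f Ω t x ξ ↔ ∀ u ∈ Ω, a ≤ preHamiltonian δ l f t x ξ u := by
  have hcont : ContinuousOn (fun u => preHamiltonian δ l f t x ξ u) Ω :=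
    (continuousOn_preHamiltonian hl hf ξ).comp (f := fun u => (t, x, u)) (by fun_prop)
      fun _ _ => ⟨ht, trivial⟩
  rw [hamiltonian, le_csInf_iff (hΩc.bddBelow_image hcont) (hΩ.image _), forall_mem_image]

theorem eventually_forall_lt_preHamiltonian
    (hl : ContinuousOn (fun p : ℝ × EuclideanSpace ℝ (Fin n) × EuclideanSpace ℝ (Fin m) =>
      l p.1 p.2.1 p.2.2) (Ici (0 : ℝ) ×ˢ univ))
    (hf : ContinuousOn (fun p : ℝ × EuclideanSpace ℝ (Fin n) × EuclideanSpace ℝ (Fin m) =>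
      f p.1 p.2.1 p.2.2) (Ici (0 : ℝ) ×ˢ univ)) (hΩ : Ω.Nonempty) (hΩc : IsCompact Ω)
    (ht : 0 ≤ t) {c : ℝ} (hc : c < hamiltonian δ l f Ω t x ξ) :
    ∀ᶠ q in 𝓝[Ici (0 : ℝ) ×ˢ univ] (t, x), ∀ u ∈ Ω, c < preHamiltonian δ l f q.1 q.2 ξ u :=
  eventually_forall_const_lt (D := Ici (0 : ℝ) ×ˢ univ) hΩc (continuousOn_uncurry_prod
      (g := fun s y u => preHamiltonian δ l f s y ξ u) (continuousOn_preHamiltonian hl hf ξ))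
    (x := (t, x)) ⟨ht, trivial⟩
    fun u hu => hc.trans_le ((le_hamiltonian_iff hl hf hΩ hΩc ht).1 le_rfl u hu)

theorem add_hamiltonian_nonpos_of_mem_diniSubgrad
    (hl : ContinuousOn (fun p : ℝ × EuclideanSpace ℝ (Fin n) × EuclideanSpace ℝ (Fin m) =>
      l p.1 p.2.1 p.2.2) (Ici (0 : ℝ) ×ˢ univ))
    (hf : ContinuousOn (fun p : ℝ × EuclideanSpace ℝ (Fin n) × EuclideanSpace ℝ (Fin m) =>
      f p.1 p.2.1 p.2.2) (Ici (0 : ℝ) ×ˢ univ)) (hΩ : Ω.Nonempty) (hΩc : IsCompact Ω)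
    (hΦ : ContinuousOn (fun q : ℝ × EuclideanSpace ℝ (Fin n) => Φ q.1 q.2) (Ici (0 : ℝ) ×ˢ univ))
    (hprox : ∀ᶠ q in 𝓝[Ici (0 : ℝ) ×ˢ univ] (t, x), ∀ ζ ∈ proxSubgrad Φ q.1 q.2,
      ζ.1 + hamiltonian δ l f Ω q.1 q.2 ζ.2 ≤ 0)
    (ht : 0 ≤ t) (hζ : ζ ∈ diniSubgrad Φ t x) : ζ.1 + hamiltonian δ l f Ω t x ζ.2 ≤ 0 := by
  have htx : (t, x) ∈ Ici (0 : ℝ) ×ˢ (univ : Set (EuclideanSpace ℝ (Fin n))) := ⟨ht, trivial⟩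
  obtain ⟨b, hb, hspeed⟩ := exists_pos_eventually_forall_norm_lt hΩc (continuousOn_uncurry_prod hf)
    htx
  refine le_of_forall_pos_le_add fun ε hε => ?_
  rw [zero_add]
  have hvalue := eventually_forall_lt_preHamiltonian hl hf hΩ hΩc ht
    (sub_lt_self (hamiltonian δ l f Ω t x ζ.2) (half_pos hε))
  obtain ⟨q, ⟨ζ', hζ', hle⟩, hqprox, hqspeed, hqvalue, hq⟩ :=
    ((frequently_exists_mem_proxSubgrad_le hΦ ht hζ hb (half_pos hε)).and_eventually
      (hprox.and (hspeed.and (hvalue.and self_mem_nhdsWithin)))).exists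
  suffices ζ.1 - ζ'.1 + hamiltonian δ l f Ω t x ζ.2 - ε ≤ hamiltonian δ l f Ω q.1 q.2 ζ'.2 by
    linarith [hqprox ζ' hζ']
  refine (le_hamiltonian_iff hl hf hΩ hΩc hq.1).2 fun u hu => ?_
  have hu_value := hqvalue u hu
  have hu_le := hle (f q.1 q.2 u) (hqspeed u hu).le
  rw [preHamiltonian] at hu_value ⊢
  linarith

theorem add_hamiltonian_nonneg_iff
    (hl : ContinuousOn (fun p : ℝ × EuclideanSpace ℝ (Fin n) × EuclideanSpace ℝ (Fin m) =>
      l p.1 p.2.1 p.2.2) (Ici (0 : ℝ) ×ˢ univ))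
    (hf : ContinuousOn (fun p : ℝ × EuclideanSpace ℝ (Fin n) × EuclideanSpace ℝ (Fin m) =>
      f p.1 p.2.1 p.2.2) (Ici (0 : ℝ) ×ˢ univ)) (hΩ : Ω.Nonempty) (hΩc : IsCompact Ω)
    (ht : 0 ≤ t) {a : ℝ} :
    0 ≤ a + hamiltonian δ l f Ω t x ξ ↔ ∀ u ∈ Ω, 0 ≤ a + preHamiltonian δ l f t x ξ u := by
  simp only [← neg_le_iff_add_nonneg', le_hamiltonian_iff hl hf hΩ hΩc ht]

theorem add_hamiltonian_nonneg_of_mem_diniSupergrad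
    (hl : ContinuousOn (fun p : ℝ × EuclideanSpace ℝ (Fin n) × EuclideanSpace ℝ (Fin m) =>
      l p.1 p.2.1 p.2.2) (Ici (0 : ℝ) ×ˢ univ))
    (hf : ContinuousOn (fun p : ℝ × EuclideanSpace ℝ (Fin n) × EuclideanSpace ℝ (Fin m) =>
      f p.1 p.2.1 p.2.2) (Ici (0 : ℝ) ×ˢ univ))
    (hfK : ∀ u ∈ Ω, ∃ K : NNReal, ∀ s, 0 ≤ s → LipschitzWith K (fun y => f s y u))
    (hΩ : Ω.Nonempty) (hΩc : IsCompact Ω)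
    (hΦ : ContinuousOn (fun q : ℝ × EuclideanSpace ℝ (Fin n) => Φ q.1 q.2) (Ici (0 : ℝ) ×ˢ univ))
    (hHJ : ∀ s, 0 < s → ∀ y, ∀ ζ ∈ proxSubgrad Φ s y, 0 ≤ ζ.1 + hamiltonian δ l f Ω s y ζ.2)
    (ht : 0 ≤ t) (hζ : ζ ∈ diniSupergrad Φ t x) : 0 ≤ ζ.1 + hamiltonian δ l f Ω t x ζ.2 := by
  refine (add_hamiltonian_nonneg_iff hl hf hΩ hΩc ht).2 fun u hu => ?_
  obtain ⟨K, hK⟩ := hfK u hu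
  refine nonneg_of_mem_diniSupergrad_of_forall_mem_proxSubgrad
    (F := fun s y => f s y u) (L := fun s y => Real.exp (-δ * s) * l s y u) hΦ
    (continuousOn_apply_snd hf u) (ContinuousOn.mul (by fun_prop) (continuousOn_apply_snd hl u)) hK
    (fun s hs y η hη => ?_) ht hζ
  exact (add_hamiltonian_nonneg_iff hl hf hΩ hΩc hs.le).1 (hHJ s hs y η hη) u hu

theorem add_hamiltonian_nonneg_of_mem_diniSubgrad
    (hl : ContinuousOn (fun p : ℝ × EuclideanSpace ℝ (Fin n) × EuclideanSpace ℝ (Fin m) =>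
      l p.1 p.2.1 p.2.2) (Ici (0 : ℝ) ×ˢ univ))
    (hf : ContinuousOn (fun p : ℝ × EuclideanSpace ℝ (Fin n) × EuclideanSpace ℝ (Fin m) =>
      f p.1 p.2.1 p.2.2) (Ici (0 : ℝ) ×ˢ univ))
    (hfK : ∀ u ∈ Ω, ∃ K : NNReal, ∀ s, 0 ≤ s → LipschitzWith K (fun y => f s y u))
    (hΩ : Ω.Nonempty) (hΩc : IsCompact Ω)
    (hΦ : ContinuousOn (fun q : ℝ × EuclideanSpace ℝ (Fin n) => Φ q.1 q.2) (Ici (0 : ℝ) ×ˢ univ))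
    (hHJ : ∀ s, 0 < s → ∀ y, ∀ ζ ∈ diniSupergrad Φ s y, 0 ≤ ζ.1 + hamiltonian δ l f Ω s y ζ.2)
    (ht : 0 < t) (hζ : ζ ∈ diniSubgrad Φ t x) : 0 ≤ ζ.1 + hamiltonian δ l f Ω t x ζ.2 := by
  refine (add_hamiltonian_nonneg_iff hl hf hΩ hΩc ht.le).2 fun u hu => ?_
  obtain ⟨K, hK⟩ := hfK u hu
  refine nonneg_of_mem_diniSubgrad_of_forall_mem_diniSupergrad
    (F := fun s y => f s y u) (L := fun s y => Real.exp (-δ * s) * l s y u) hΦ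
    (continuousOn_apply_snd hf u) (ContinuousOn.mul (by fun_prop) (continuousOn_apply_snd hl u)) hK
    (fun s hs y η hη => ?_) ht hζ
  exact (add_hamiltonian_nonneg_iff hl hf hΩ hΩc hs.le).1 (hHJ s hs y η hη) u hu

end Hamiltonian

theorem proposition4p1_general {n m : ℕ} {δ : ℝ}
    {l : ℝ → EuclideanSpace ℝ (Fin n) → EuclideanSpace ℝ (Fin m) → ℝ}
    {f : ℝ → EuclideanSpace ℝ (Fin n) → EuclideanSpace ℝ (Fin m) → EuclideanSpace ℝ (Fin n)}
    {Ω : Set (EuclideanSpace ℝ (Fin m))} (hΩ : Ω.Nonempty)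
    (hfK : ∀ u ∈ Ω, ∃ K : NNReal, ∀ t, 0 ≤ t → LipschitzWith K (fun x => f t x u))
    (hl : ContinuousOn (fun p : ℝ × EuclideanSpace ℝ (Fin n) × EuclideanSpace ℝ (Fin m) =>
      l p.1 p.2.1 p.2.2) (Ici (0 : ℝ) ×ˢ univ))
    (hf : ContinuousOn (fun p : ℝ × EuclideanSpace ℝ (Fin n) × EuclideanSpace ℝ (Fin m) =>
      f p.1 p.2.1 p.2.2) (Ici (0 : ℝ) ×ˢ univ))
    (hΩc : IsCompact Ω) {Φ : ℝ → EuclideanSpace ℝ (Fin n) → ℝ}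
    (hΦ : ContinuousOn (fun q : ℝ × EuclideanSpace ℝ (Fin n) => Φ q.1 q.2)
      (Ici (0 : ℝ) ×ˢ univ)) :
    ((∀ s : ℝ, 0 ≤ s → ∀ z : EuclideanSpace ℝ (Fin n),
        (⨆ p ∈ proxSubgrad Φ s z, ((p.1 + hamiltonian δ l f Ω s z p.2 : ℝ) : EReal)) ≤ 0) ↔
      (∀ s : ℝ, 0 ≤ s → ∀ z : EuclideanSpace ℝ (Fin n),
        (⨆ p ∈ diniSubgrad Φ s z, ((p.1 + hamiltonian δ l f Ω s z p.2 : ℝ) : EReal)) ≤ 0)) ∧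
    ((∀ s : ℝ, 0 < s → ∀ z : EuclideanSpace ℝ (Fin n),
        (⨆ p ∈ proxSubgrad Φ s z, ((p.1 + hamiltonian δ l f Ω s z p.2 : ℝ) : EReal)) ≤ 0) ↔
      (∀ s : ℝ, 0 < s → ∀ z : EuclideanSpace ℝ (Fin n),
        (⨆ p ∈ diniSubgrad Φ s z, ((p.1 + hamiltonian δ l f Ω s z p.2 : ℝ) : EReal)) ≤ 0)) ∧
    ((∀ s : ℝ, 0 < s → ∀ z : EuclideanSpace ℝ (Fin n),
        0 ≤ (⨅ p ∈ proxSubgrad Φ s z, ((p.1 + hamiltonian δ l f Ω s z p.2 : ℝ) : EReal))) ↔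
      (∀ s : ℝ, 0 < s → ∀ z : EuclideanSpace ℝ (Fin n),
        0 ≤ (⨅ p ∈ diniSupergrad Φ s z, ((p.1 + hamiltonian δ l f Ω s z p.2 : ℝ) : EReal)))) ∧
    ((∀ s : ℝ, 0 < s → ∀ z : EuclideanSpace ℝ (Fin n),
        0 ≤ (⨅ p ∈ proxSubgrad Φ s z, ((p.1 + hamiltonian δ l f Ω s z p.2 : ℝ) : EReal))) ↔
      (∀ s : ℝ, 0 ≤ s → ∀ z : EuclideanSpace ℝ (Fin n),
        0 ≤ (⨅ p ∈ diniSupergrad Φ s z, ((p.1 + hamiltonian δ l f Ω s z p.2 : ℝ) : EReal)))) := by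
  simp only [iSup_le_iff, le_iInf_iff, EReal.coe_nonpos, EReal.coe_nonneg]
  refine ⟨⟨fun h s hs z p hp => ?_, fun h s hs z p hp => ?_⟩,
    ⟨fun h s hs z p hp => ?_, fun h s hs z p hp => ?_⟩,
    ⟨fun h s hs z p hp => ?_, fun h s hs z p hp => ?_⟩,
    ⟨fun h s hs z p hp => ?_, fun h s hs z p hp => ?_⟩⟩
  · refine add_hamiltonian_nonpos_of_mem_diniSubgrad hl hf hΩ hΩc hΦ ?_ hs hp
    filter_upwards [self_mem_nhdsWithin] with q hq using h q.1 hq.1 q.2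
  · exact h s hs z p (proxSubgrad_subset_diniSubgrad hp)
  · refine add_hamiltonian_nonpos_of_mem_diniSubgrad hl hf hΩ hΩc hΦ ?_ hs.le hp
    filter_upwards [mem_nhdsWithin_of_mem_nhds (prod_mem_nhds (Ioi_mem_nhds hs) univ_mem)]
      with q hq using h q.1 hq.1 q.2
  · exact h s hs z p (proxSubgrad_subset_diniSubgrad hp)
  · exact add_hamiltonian_nonneg_of_mem_diniSupergrad hl hf hfK hΩ hΩc hΦ h hs.le hp
  · exact add_hamiltonian_nonneg_of_mem_diniSubgrad hl hf hfK hΩ hΩc hΦ h hs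
      (proxSubgrad_subset_diniSubgrad hp)
  · exact add_hamiltonian_nonneg_of_mem_diniSupergrad hl hf hfK hΩ hΩc hΦ h hs hp
  · exact add_hamiltonian_nonneg_of_mem_diniSubgrad hl hf hfK hΩ hΩc hΦ
      (fun s hs => h s hs.le) hs (proxSubgrad_subset_diniSubgrad hp)

theorem proposition4p1 {n m : ℕ} (δ : ℝ) (hδ : 0 < δ)
    (l : ℝ → EuclideanSpace ℝ (Fin n) → EuclideanSpace ℝ (Fin m) → ℝ)
    (f : ℝ → EuclideanSpace ℝ (Fin n) → EuclideanSpace ℝ (Fin m) → EuclideanSpace ℝ (Fin n))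
    (Ω : Set (EuclideanSpace ℝ (Fin m))) (hΩ : Ω.Nonempty)
    (A1 : ∃ K₁ : ℝ, 0 < K₁ ∧ ∀ t : ℝ, 0 ≤ t → ∀ u ∈ Ω, ∀ x z : EuclideanSpace ℝ (Fin n),
      |l t x u - l t z u| + ‖f t x u - f t z u‖ ≤ K₁ * ‖x - z‖)
    (A2 : ∃ K₂ : ℝ, 0 < K₂ ∧ ∀ t : ℝ, 0 ≤ t → ∀ x : EuclideanSpace ℝ (Fin n), ∀ u ∈ Ω,
      |l t x u| + ‖f t x u‖ ≤ K₂ * (1 + ‖x‖))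
    (A3l : ContinuousOn
      (fun p : ℝ × EuclideanSpace ℝ (Fin n) × EuclideanSpace ℝ (Fin m) => l p.1 p.2.1 p.2.2)
      (Ici (0 : ℝ) ×ˢ univ))
    (A3f : ContinuousOn
      (fun p : ℝ × EuclideanSpace ℝ (Fin n) × EuclideanSpace ℝ (Fin m) => f p.1 p.2.1 p.2.2)
      (Ici (0 : ℝ) ×ˢ univ))
    (A4 : ∀ t : ℝ, 0 ≤ t → ∀ x : EuclideanSpace ℝ (Fin n),
      Convex ℝ ((fun v => (Real.exp (-δ * t) * l t x v, f t x v)) '' Ω))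
    (A5 : IsCompact Ω)
    (Φ : ℝ → EuclideanSpace ℝ (Fin n) → ℝ)
    (hΦ : ContinuousOn (fun p : ℝ × EuclideanSpace ℝ (Fin n) => Φ p.1 p.2)
      (Ici (0 : ℝ) ×ˢ univ)) :
    -- (a), over all points of `[0,∞) × ℝⁿ`
    ((∀ s : ℝ, 0 ≤ s → ∀ z : EuclideanSpace ℝ (Fin n),
        (⨆ p ∈ proxSubgrad Φ s z, ((p.1 + hamiltonian δ l f Ω s z p.2 : ℝ) : EReal)) ≤ 0) ↔
      (∀ s : ℝ, 0 ≤ s → ∀ z : EuclideanSpace ℝ (Fin n),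
        (⨆ p ∈ diniSubgrad Φ s z, ((p.1 + hamiltonian δ l f Ω s z p.2 : ℝ) : EReal)) ≤ 0)) ∧
    -- (a), over all points of `(0,∞) × ℝⁿ`
    ((∀ s : ℝ, 0 < s → ∀ z : EuclideanSpace ℝ (Fin n),
        (⨆ p ∈ proxSubgrad Φ s z, ((p.1 + hamiltonian δ l f Ω s z p.2 : ℝ) : EReal)) ≤ 0) ↔
      (∀ s : ℝ, 0 < s → ∀ z : EuclideanSpace ℝ (Fin n),
        (⨆ p ∈ diniSubgrad Φ s z, ((p.1 + hamiltonian δ l f Ω s z p.2 : ℝ) : EReal)) ≤ 0)) ∧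
    -- (b), over all points of `(0,∞) × ℝⁿ`
    ((∀ s : ℝ, 0 < s → ∀ z : EuclideanSpace ℝ (Fin n),
        0 ≤ (⨅ p ∈ proxSubgrad Φ s z, ((p.1 + hamiltonian δ l f Ω s z p.2 : ℝ) : EReal))) ↔
      (∀ s : ℝ, 0 < s → ∀ z : EuclideanSpace ℝ (Fin n),
        0 ≤ (⨅ p ∈ diniSupergrad Φ s z, ((p.1 + hamiltonian δ l f Ω s z p.2 : ℝ) : EReal)))) ∧
    -- (b), with the Dini inequality over all points of `[0,∞) × ℝⁿ`
    ((∀ s : ℝ, 0 < s → ∀ z : EuclideanSpace ℝ (Fin n),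
        0 ≤ (⨅ p ∈ proxSubgrad Φ s z, ((p.1 + hamiltonian δ l f Ω s z p.2 : ℝ) : EReal))) ↔
      (∀ s : ℝ, 0 ≤ s → ∀ z : EuclideanSpace ℝ (Fin n),
        0 ≤ (⨅ p ∈ diniSupergrad Φ s z, ((p.1 + hamiltonian δ l f Ω s z p.2 : ℝ) : EReal)))) := by
  obtain ⟨K₁, -, hK₁⟩ := A1
  refine proposition4p1_general hΩ (fun u hu => ⟨K₁.toNNReal, fun t ht => ?_⟩) A3l A3f A5 hΦ
  exact LipschitzWith.of_dist_le' fun x z => by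
    rw [dist_eq_norm, dist_eq_norm]
    exact (le_add_of_nonneg_left (abs_nonneg _)).trans (hK₁ t ht u hu x z)
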